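/- **Setting.** Let $\mathcal G_{SP}$ be a finite directed graph (parallel edges and self loops allowed) with edge set $S\uplus P$; the edges in $P$ are the *ports*. A *linear multiport* $\mathcal N_P=(\mathcal G_{SP},\mathcal A_{S'S''})$ is such a graph together with a (nonempty) affine space $\mathcal A_{S'S''}$, the device characteristic, of real vectors $(v_{S'},i_{S''})$. Its solutions are the pairs $(v,i)$ of real vectors on $S\uplus P$ such that $v$ satisfies Kirchhoff's voltage law, $i$ satisfies Kirchhoff's current law and $(v|_S,i|_S)\in\mathcal A_{S'S''}$; its port behaviour $\mathcal A_{P'P''}$ is the set of the restrictions $(v|_P,i|_P)$ of its solutions. $\mathcal N_P$ is *rigid* if for every translate $\hat{\mathcal A}_{S'S''}$ of $\mathcal A_{S'S''}$ the multiport $(\mathcal G_{SP},\hat{\mathcal A}_{S'S''})$ has a solution and has exactly one solution for each vector in its port behaviour. It is *proper* if it is rigid and the vector space translate of $\mathcal A_{S'S''}$ has dimension $|S|$. A *column base* of a vector space of vectors on a finite set $X$ is a subset of $X$ indexing a maximal linearly independent set of columns of a matrix whose rows form a basis of the space. A *loop* is the edge set of a cycle (a self loop being a cycle of length one), a *cutset*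 is a minimal set of edges whose deletion increases the number of connected components by one, and a *tree* is a maximal set of edges containing no loop (a spanning tree if the graph is connected, a spanning forest in general). **Theorem.** Let $\mathcal N_P$ be a linear multiport on $\mathcal G_{SP}$ with $$S=\tilde Y_1\uplus\tilde Z_1\uplus\tilde Y_2\uplus\tilde Z_2\uplus\hat Y_1\uplus\hat Z_2\uplus\hat Y_2\uplus\hat Z_1\uplus R\uplus E\uplus J,$$ whose device characteristic is the solution space of - (CCVS) $v_{\tilde Y_1}=0,\ v_{\tilde Z_1}=r\,i_{\tilde Y_1}$; (VCCS) $i_{\tilde Y_2}=0,\ i_{\tilde Z_2}=g\,v_{\tilde Y_2}$; - (CCCS) $v_{\hat Y_1}=0,\ i_{\hat Z_2}=\alpha\,i_{\hat Y_1}$; (VCVS) $i_{\hat Y_2}=0,\ v_{\hat Z_1}=\beta\,v_{\hat Y_2}$; - (resistors) $v_R=\hat R\,i_R$; (voltage sources) $v_E=s_E$; (current sources) $i_J=s_J$, where $r,g,\alpha,\beta,\hat R$ are real diagonal (square) matrices, so that each controlling branch controls exactly one controlled branch, and $s_E,s_J$ are arbitrary real vectors. Assume that the diagonal entries of $r,g,\alpha,\beta,\hat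 R$ are together algebraically independent over $\mathbb Q$. Put $Y_1=\tilde Y_1\uplus\hat Y_1$ (controlling current branches), $Y_2=\tilde Y_2\uplus\hat Y_2$ (controlling voltage branches), $Z_1=\tilde Z_1\uplus\hat Z_1$ (controlled voltage sources), $Z_2=\tilde Z_2\uplus\hat Z_2$ (controlled current sources). Then: 1. If $\mathcal N_P$ is proper, then $Y_1\uplus E$ contains no loop of $\mathcal G_{SP}$ and $Y_2\uplus J$ contains no cutset of $\mathcal G_{SP}$. 2. If $Z_1\uplus Y_1\uplus E$ contains no loop and $Z_2\uplus Y_2\uplus J$ contains no cutset of $\mathcal G_{SP}$, then $\mathcal N_P$ is proper. 3. Under the conditions of 2, there is a tree $t$ of $\mathcal G_{SP}$ that contains $Z_1\uplus Y_1\uplus E$ and does not meet $Z_2\uplus Y_2\uplus J$. For every such tree $t$, writing $P_1=t\cap P$ and $P_2=P-t$, the port behaviour has a hybrid representation, i.e. there are real matrices $g_{11},h_{12},h_{21},r_{22}$ and a real vector $s$ such that the port behaviour is exactly the set of all $(v_{P'},i_{P''})$ with $$\begin{pmatrix} i_{P_1}\\ v_{P_2}\end{pmatrix}=\begin{pmatrix}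 g_{11}&h_{12}\\ h_{21}&r_{22}\end{pmatrix}\begin{pmatrix} v_{P_1}\\ i_{P_2}\end{pmatrix}+s,$$ and $P_1'\uplus P_2''=(t\cap P)'\uplus(P-t)''$ is a column base of the vector space translate of the port behaviour. -/

import Mathlib

namespace Multiport

/-! ### Directed graphs (multi-edges and self loops allowed) -/

/-- A directed graph with node set `N` and edge set `E`: every edge has a positive and a negative
endpoint, and its arrow goes from the former to the latter. -/
structure DiGraph (N E : Type*) where
  pos : E → N
  neg : E → N

namespace DiGraph

variable {N E : Type*}

/-- Starting node of an oriented edge; `(e, true)` is `e` traversed along its arrow,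
`(e, false)` is `e` traversed against its arrow. -/
def tail (G : DiGraph N E) : E × Bool → N
  | (e, true) => G.pos e
  | (e, false) => G.neg e

/-- Final node of an oriented edge. -/
def head (G : DiGraph N E) : E × Bool → N
  | (e, true) => G.neg e
  | (e, false) => G.pos e

/-- An oriented loop: a nonempty closed chain of oriented edges that repeats no node and no edge.
A self loop is a loop with one edge, two parallel edges form a loop with two edges. -/
structure IsOrientedLoop (G : DiGraph N E) (l : List (E × Bool)) : Prop where
  ne_nil : l ≠ []
  chain : l.IsChain (fun a b => G.head a = G.tail b)
  closed : ∀ a ∈ l.getLast?, ∀ b ∈ l.head?, G.head a = G.tail b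
  nodes_nodup : (l.map G.tail).Nodup
  edges_nodup : (l.map Prod.fst).Nodup

/-- `C` is the edge set of a loop. -/
def IsLoop (G : DiGraph N E) (C : Set E) : Prop :=
  ∃ l, G.IsOrientedLoop l ∧ C = {e | e ∈ l.map Prod.fst}

/-- The set of edges `T` contains a loop. -/
def ContainsLoop (G : DiGraph N E) (T : Set E) : Prop :=
  ∃ C, C ⊆ T ∧ G.IsLoop C

/-- Number of connected components of the graph on all the nodes that keeps only the edges in `T`
(`Quot` passes to the equivalence relation generated by adjacency). -/
noncomputable def numComponents (G : DiGraph N E) (T : Set E) : ℕ :=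
  Nat.card (Quot fun x y : N => ∃ e ∈ T, G.pos e = x ∧ G.neg e = y)

/-- A cutset: a minimal set of edges whose deletion increases the number of connected components
by one. -/
def IsCutset (G : DiGraph N E) (C : Set E) : Prop :=
  Minimal (fun D : Set E => G.numComponents Dᶜ = G.numComponents Set.univ + 1) C

/-- The set of edges `T` contains a cutset. -/
def ContainsCutset (G : DiGraph N E) (T : Set E) : Prop :=
  ∃ C, C ⊆ T ∧ G.IsCutset C

/-- A (spanning) tree, given by its edge set: a maximal set of edges containing no loop. If the
graph is not connected this is a spanning forest. -/
def IsTree (G : DiGraph N E) (t : Set E) : Prop :=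
  Maximal (fun T : Set E => ¬ G.ContainsLoop T) t

/-- Kirchhoff's voltage law: the signed sum of the voltages around each oriented loop is zero. -/
def kvl (G : DiGraph N E) : Submodule ℝ (E → ℝ) where
  carrier := {v | ∀ l, G.IsOrientedLoop l →
    (l.map fun d : E × Bool => if d.2 then v d.1 else -v d.1).sum = 0}
  zero_mem' := by
    intro l _
    simp
  add_mem' := by
    intro v w hv hw l hl
    have h : (fun d : E × Bool => if d.2 then (v + w) d.1 else -(v + w) d.1) =
        fun d => (if d.2 then v d.1 else -v d.1) + (if d.2 then w d.1 else -w d.1) := by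
      funext d
      cases d.2 <;> simp [add_comm]
    rw [h, List.sum_map_add, hv l hl, hw l hl, add_zero]
  smul_mem' := by
    intro c v hv l hl
    have h : (fun d : E × Bool => if d.2 then (c • v) d.1 else -(c • v) d.1) =
        fun d => c * (if d.2 then v d.1 else -v d.1) := by
      funext d
      cases d.2 <;> simp
    rw [h, List.sum_map_mul_left, hv l hl, mul_zero]

open Classical in
/-- Kirchhoff's current law: the signed sum of the currents leaving each node is zero. -/
def kcl [Fintype E] (G : DiGraph N E) : Submodule ℝ (E → ℝ) where
  carrier := {i | ∀ n : N, (∑ e with G.pos e = n, i e) - ∑ e with G.neg e = n, i e = 0}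
  zero_mem' := by
    intro n
    simp
  add_mem' := by
    intro i j hi hj n
    have h1 := hi n
    have h2 := hj n
    simp only [Pi.add_apply, Finset.sum_add_distrib]
    linarith
  smul_mem' := by
    intro c i hi n
    have h1 := hi n
    simp only [Pi.smul_apply, smul_eq_mul, ← Finset.mul_sum]
    rw [← mul_sub, h1, mul_zero]

end DiGraph

/-! ### Vectors of voltages and currents

A vector on `X' ⊎ X''`, where `X'` and `X''` are disjoint copies of `X`, is a function on `X ⊕ X`:
its value at `inl e` is the voltage of `e`, its value at `inr e` the current of `e`. -/

/-- The voltage part of a vector on `X' ⊎ X''`. -/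
def volt {X : Type*} : (X ⊕ X → ℝ) →ₗ[ℝ] (X → ℝ) := LinearMap.funLeft ℝ ℝ Sum.inl

/-- The current part of a vector on `X' ⊎ X''`. -/
def curr {X : Type*} : (X ⊕ X → ℝ) →ₗ[ℝ] (X → ℝ) := LinearMap.funLeft ℝ ℝ Sum.inr

/-- Restriction of a vector on `(S ⊎ P)' ⊎ (S ⊎ P)''` to `S' ⊎ S''`. -/
def restrictS {S P : Type*} : ((S ⊕ P) ⊕ (S ⊕ P) → ℝ) →ₗ[ℝ] (S ⊕ S → ℝ) :=
  LinearMap.funLeft ℝ ℝ (Sum.map Sum.inl Sum.inl)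

/-- Restriction of a vector on `(S ⊎ P)' ⊎ (S ⊎ P)''` to `P' ⊎ P''`. -/
def restrictP {S P : Type*} : ((S ⊕ P) ⊕ (S ⊕ P) → ℝ) →ₗ[ℝ] (P ⊕ P → ℝ) :=
  LinearMap.funLeft ℝ ℝ (Sum.map Sum.inr Sum.inr)

/-! ### Linear multiports -/

end Multiport

/-- A linear multiport with node set `N`, internal (device) edges `S` and port edges `P`: a directed
graph with edge set `S ⊎ P` and an affine device characteristic on `S' ⊎ S''`. -/
structure LinearMultiport (N S P : Type*) where
  graph : Multiport.DiGraph N (S ⊕ P)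
  device : AffineSubspace ℝ (S ⊕ S → ℝ)
  device_nonempty : (device : Set (S ⊕ S → ℝ)).Nonempty

namespace LinearMultiport

open Multiport

variable {N S P : Type*} [Fintype S] [Fintype P]

/-- Vectors satisfying KVL, KCL and the device characteristic. -/
def solutions (M : LinearMultiport N S P) : AffineSubspace ℝ ((S ⊕ P) ⊕ (S ⊕ P) → ℝ) :=
  (M.graph.kvl.comap volt ⊓ M.graph.kcl.comap curr).toAffineSubspace ⊓
    M.device.comap restrictS.toAffineMap

/-- The port behaviour: the restrictions of the solutions to `P' ⊎ P''`. -/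
def behaviour (M : LinearMultiport N S P) : AffineSubspace ℝ (P ⊕ P → ℝ) :=
  M.solutions.map restrictP.toAffineMap

/-- A multiport is rigid if every multiport on the same graph, whose device characteristic is a
translate of the given one, has a solution, and has exactly one solution for each vector in its
port behaviour. -/
def IsRigid (M : LinearMultiport N S P) : Prop :=
  ∀ M' : LinearMultiport N S P, M'.graph = M.graph → M'.device.direction = M.device.direction →
    (∃ x, x ∈ M'.solutions) ∧
      ∀ b ∈ M'.behaviour, ∃! x, x ∈ M'.solutions ∧ restrictP x = b

/-- A multiport is proper if it is rigid and its device characteristic is proper, i.e. has a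
vector space translate of dimension `|S|`. -/
def IsProper (M : LinearMultiport N S P) : Prop :=
  M.IsRigid ∧ Module.finrank ℝ M.device.direction = Fintype.card S

end LinearMultiport

namespace Multiport

/-! ### Column bases and hybrid representations -/

/-- `B` is a representative matrix of the vector space `W` on `X`: its rows are linearly
independent and span `W`. -/
def IsRepresentativeMatrix {X : Type*} {n : ℕ} (B : Matrix (Fin n) X ℝ)
    (W : Submodule ℝ (X → ℝ)) : Prop :=
  LinearIndependent ℝ B.row ∧ Submodule.span ℝ (Set.range B.row) = W

/-- The columns `T` of the vector space `W` are independent: they are linearly independent columns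
of a representative matrix (the choice of which does not matter). -/
def ColumnsIndependent {X : Type*} (W : Submodule ℝ (X → ℝ)) (T : Set X) : Prop :=
  ∃ (n : ℕ) (B : Matrix (Fin n) X ℝ), IsRepresentativeMatrix B W ∧ LinearIndepOn ℝ B.col T

/-- A column base of a vector space: a maximal independent set of columns. -/
def IsColumnBase {X : Type*} (W : Submodule ℝ (X → ℝ)) (T : Set X) : Prop :=
  Maximal (ColumnsIndependent W) T

open Classical in
/-- With `P₂ = P - P₁`, the affine space `A` on `P' ⊎ P''` is the solution set of
`(i_{P₁}, v_{P₂}) = [g h; k r] (v_{P₁}, i_{P₂}) + s`. -/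
def HasHybridRepresentation {P : Type*} [Fintype P] (A : AffineSubspace ℝ (P ⊕ P → ℝ))
    (P₁ : Set P) : Prop :=
  ∃ (g : Matrix P₁ P₁ ℝ) (h : Matrix P₁ ↥P₁ᶜ ℝ) (k : Matrix ↥P₁ᶜ P₁ ℝ) (r : Matrix ↥P₁ᶜ ↥P₁ᶜ ℝ)
    (s : P₁ ⊕ ↥P₁ᶜ → ℝ), ∀ f : P ⊕ P → ℝ, f ∈ A ↔
      Sum.elim (fun p : P₁ => curr f p) (fun p : ↥P₁ᶜ => volt f p) =
        (Matrix.fromBlocks g h k r).mulVec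
          (Sum.elim (fun p : P₁ => volt f p) (fun p : ↥P₁ᶜ => curr f p)) + s

/-! ### Multiports made of resistors, independent sources and controlled sources -/

/-- The device branches of a multiport whose CCVS, VCCS, CCCS and VCVS devices, resistors, voltage
sources and current sources are indexed by the given types. A controlled source has a controlling
branch (`Ctrl`) and a controlled branch (`Src`). -/
inductive Branch (CCVS VCCS CCCS VCVS Res VSrc ISrc : Type*)
  | ccvsCtrl (d : CCVS)
  | ccvsSrc (d : CCVS)
  | vccsCtrl (d : VCCS)
  | vccsSrc (d : VCCS)
  | cccsCtrl (d : CCCS)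
  | cccsSrc (d : CCCS)
  | vcvsCtrl (d : VCVS)
  | vcvsSrc (d : VCVS)
  | resistor (d : Res)
  | vsource (d : VSrc)
  | isource (d : ISrc)
  deriving Fintype

/-- The parameters of the devices: transresistances `r`, transconductances `g`, current gains `α`,
voltage gains `β`, resistances `R`, and the values `sE`, `sJ` of the independent sources. -/
structure Parameters (CCVS VCCS CCCS VCVS Res VSrc ISrc : Type*) where
  r : CCVS → ℝ
  g : VCCS → ℝ
  α : CCCS → ℝ
  β : VCVS → ℝ
  R : Res → ℝ
  sE : VSrc → ℝ
  sJ : ISrc → ℝ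

variable {CCVS VCCS CCCS VCVS Res VSrc ISrc : Type*}

namespace Parameters

/-- The controlled source parameters and the resistances, as a single family. -/
def values (p : Parameters CCVS VCCS CCCS VCVS Res VSrc ISrc) :
    CCVS ⊕ VCCS ⊕ CCCS ⊕ VCVS ⊕ Res → ℝ :=
  Sum.elim p.r (Sum.elim p.g (Sum.elim p.α (Sum.elim p.β p.R)))

/-- The equations of the devices. -/
structure Satisfies (p : Parameters CCVS VCCS CCCS VCVS Res VSrc ISrc)
    (f : Branch CCVS VCCS CCCS VCVS Res VSrc ISrc ⊕ Branch CCVS VCCS CCCS VCVS Res VSrc ISrc → ℝ) :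
    Prop where
  ccvsCtrl : ∀ d, volt f (.ccvsCtrl d) = 0
  ccvsSrc : ∀ d, volt f (.ccvsSrc d) = p.r d * curr f (.ccvsCtrl d)
  vccsCtrl : ∀ d, curr f (.vccsCtrl d) = 0
  vccsSrc : ∀ d, curr f (.vccsSrc d) = p.g d * volt f (.vccsCtrl d)
  cccsCtrl : ∀ d, volt f (.cccsCtrl d) = 0
  cccsSrc : ∀ d, curr f (.cccsSrc d) = p.α d * curr f (.cccsCtrl d)
  vcvsCtrl : ∀ d, curr f (.vcvsCtrl d) = 0
  vcvsSrc : ∀ d, volt f (.vcvsSrc d) = p.β d * volt f (.vcvsCtrl d)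
  resistor : ∀ d, volt f (.resistor d) = p.R d * curr f (.resistor d)
  vsource : ∀ d, volt f (.vsource d) = p.sE d
  isource : ∀ d, curr f (.isource d) = p.sJ d

/-- The device characteristic: the solution space of the equations of the devices. -/
def device (p : Parameters CCVS VCCS CCCS VCVS Res VSrc ISrc) :
    AffineSubspace ℝ (Branch CCVS VCCS CCCS VCVS Res VSrc ISrc ⊕
      Branch CCVS VCCS CCCS VCVS Res VSrc ISrc → ℝ) where
  carrier := {f | p.Satisfies f}
  smul_vsub_vadd_mem' := by
    intro c f₁ f₂ f₃ h₁ h₂ h₃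
    constructor <;> intro d <;>
      simp only [vsub_eq_sub, vadd_eq_add, map_add, map_smul, map_sub, Pi.add_apply, Pi.smul_apply,
        Pi.sub_apply, smul_eq_mul, h₁.ccvsCtrl, h₁.ccvsSrc, h₁.vccsCtrl, h₁.vccsSrc, h₁.cccsCtrl,
        h₁.cccsSrc, h₁.vcvsCtrl, h₁.vcvsSrc, h₁.resistor, h₁.vsource, h₁.isource,
        h₂.ccvsCtrl, h₂.ccvsSrc, h₂.vccsCtrl, h₂.vccsSrc, h₂.cccsCtrl,
        h₂.cccsSrc, h₂.vcvsCtrl, h₂.vcvsSrc, h₂.resistor, h₂.vsource, h₂.isource,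
        h₃.ccvsCtrl, h₃.ccvsSrc, h₃.vccsCtrl, h₃.vccsSrc, h₃.cccsCtrl,
        h₃.cccsSrc, h₃.vcvsCtrl, h₃.vcvsSrc, h₃.resistor, h₃.vsource, h₃.isource] <;>
      ring

theorem device_nonempty (p : Parameters CCVS VCCS CCCS VCVS Res VSrc ISrc) :
    (p.device : Set (Branch CCVS VCCS CCCS VCVS Res VSrc ISrc ⊕
      Branch CCVS VCCS CCCS VCVS Res VSrc ISrc → ℝ)).Nonempty := by
  refine ⟨fun
    | .inl (.vsource d) => p.sE d
    | .inr (.isource d) => p.sJ d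
    | _ => 0, ?_⟩
  change p.Satisfies _
  constructor <;> intro d <;> simp [volt, curr, LinearMap.funLeft_apply]

/-- The multiport on the graph `G` with devices given by the parameters `p`. -/
def multiport {N P : Type*} (p : Parameters CCVS VCCS CCCS VCVS Res VSrc ISrc)
    (G : DiGraph N (Branch CCVS VCCS CCCS VCVS Res VSrc ISrc ⊕ P)) :
    LinearMultiport N (Branch CCVS VCCS CCCS VCVS Res VSrc ISrc) P where
  graph := G
  device := p.device
  device_nonempty := p.device_nonempty

end Parameters

/-- `Y₁`: the controlling current branches (of the CCVS and CCCS devices). -/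
def Y₁ (P : Type*) : Set (Branch CCVS VCCS CCCS VCVS Res VSrc ISrc ⊕ P) :=
  Set.range (fun d => .inl (.ccvsCtrl d)) ∪ Set.range (fun d => .inl (.cccsCtrl d))

/-- `Y₂`: the controlling voltage branches (of the VCCS and VCVS devices). -/
def Y₂ (P : Type*) : Set (Branch CCVS VCCS CCCS VCVS Res VSrc ISrc ⊕ P) :=
  Set.range (fun d => .inl (.vccsCtrl d)) ∪ Set.range (fun d => .inl (.vcvsCtrl d))

/-- `Z₁`: the controlled voltage source branches (of the CCVS and VCVS devices). -/
def Z₁ (P : Type*) : Set (Branch CCVS VCCS CCCS VCVS Res VSrc ISrc ⊕ P) :=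
  Set.range (fun d => .inl (.ccvsSrc d)) ∪ Set.range (fun d => .inl (.vcvsSrc d))

/-- `Z₂`: the controlled current source branches (of the VCCS and CCCS devices). -/
def Z₂ (P : Type*) : Set (Branch CCVS VCCS CCCS VCVS Res VSrc ISrc ⊕ P) :=
  Set.range (fun d => .inl (.vccsSrc d)) ∪ Set.range (fun d => .inl (.cccsSrc d))

/-- `E`: the independent voltage source branches. -/
def E (P : Type*) : Set (Branch CCVS VCCS CCCS VCVS Res VSrc ISrc ⊕ P) :=
  Set.range (fun d => .inl (.vsource d))

/-- `J`: the independent current source branches. -/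
def J (P : Type*) : Set (Branch CCVS VCCS CCCS VCVS Res VSrc ISrc ⊕ P) :=
  Set.range (fun d => .inl (.isource d))

end Multiport

/-! KVL says that the voltages are potential differences (`mem_kvl_iff`), KCL that the currents are
orthogonal to all potential differences (`mem_kcl_iff`). A tree `t` therefore gives coordinates on
the Kirchhoff space: tree voltages and cotree currents are free, collected in one vector `x`, and `v
= A x`, `i = B x` with integer matrices (`exists_isTreeParametrization`).

In these coordinates the network becomes a square system: one device equation per device branch, and
one equation fixing `x` at each port, that is, the port voltage on `t` and the port current off `t`.
If its matrix is nonsingular, device right-hand sides and port inputs can be prescribed at will and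
determine the solution. This yields rigidity and the dimension `|S|` (`isProper`) and, by solving
for the complementary port variables, the hybrid form (`exists_isHybridForm`). The direction of the
behaviour is then a graph over the port inputs, hence the column base.

The determinant is a polynomial in the device parameters with rational coefficients, so for
algebraically independent parameters it is nonzero as soon as it is nonzero at one point
(`det_networkMatrix_ne_zero`). If `t` contains `Z₁ ∪ Y₁ ∪ E` and avoids `Z₂ ∪ Y₂ ∪ J`, such a point
has all controlled sources off, tree resistors shorted, and the other resistances equal to one: a
homogeneous solution has zero tree voltages, hence zero voltages, hence zero cotree currents. Such a
tree exists by the loop and cutset conditions (`exists_isTree`).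

Conversely, rigidity allows arbitrary voltages on `Y₁ ∪ E` and arbitrary currents on `Y₂ ∪ J`; a
loop in the former or a cutset in the latter would impose a linear relation on them. -/

namespace Multiport.DiGraph

/-! ### Walks, paths and loops. -/

variable {N E : Type*}

/-- Two nodes are adjacent in `T` if they are the positive and negative endpoints of an edge
in `T`. -/
def Adj (G : DiGraph N E) (T : Set E) (x y : N) : Prop := ∃ e ∈ T, G.pos e = x ∧ G.neg e = y

/-- The connected component of a node in the graph that keeps only the edges in `T`. -/
def component (G : DiGraph N E) (T : Set E) (x : N) : Quot (G.Adj T) := Quot.mk _ x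

/-- The potential differences along the edges. -/
def coboundary (G : DiGraph N E) (φ : N → ℝ) (e : E) : ℝ := φ (G.pos e) - φ (G.neg e)

/-- The value of `v` on an oriented edge. -/
def signed (v : E → ℝ) (d : E × Bool) : ℝ := if d.2 then v d.1 else -v d.1

/-- `l` is a walk from `x` to `y`. -/
def IsWalk (G : DiGraph N E) : N → N → List (E × Bool) → Prop
  | x, y, [] => x = y
  | x, y, a :: l => G.tail a = x ∧ IsWalk G (G.head a) y l

/-- `l` is a walk from `x` to `y` with edges in `T`, and it repeats no node and no edge. -/
structure IsPathIn (G : DiGraph N E) (T : Set E) (x y : N) (l : List (E × Bool)) : Prop where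
  walk : G.IsWalk x y l
  subset : ∀ a ∈ l, a.1 ∈ T
  nodes_nodup : (l.map G.tail).Nodup
  notMem : y ∉ l.map G.tail
  edges_nodup : (l.map Prod.fst).Nodup

variable {G : DiGraph N E} {T T' : Set E} {x y z : N} {l : List (E × Bool)}

theorem component_pos_eq {e : E} (he : e ∈ T) :
    G.component T (G.pos e) = G.component T (G.neg e) :=
  Quot.sound ⟨e, he, rfl, rfl⟩

/-- A predicate invariant along the edges of `T` descends to the components. This replaces induction
on connecting walks throughout. -/
theorem iff_of_component_eq {p : N → Prop} (h : ∀ e ∈ T, p (G.pos e) ↔ p (G.neg e))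
    (hxy : G.component T x = G.component T y) : p x ↔ p y := by
  have h' : ∀ a b, G.Adj T a b → p a = p b := by
    rintro a b ⟨e, he, rfl, rfl⟩
    exact propext (h e he)
  exact iff_of_eq (congrArg (Quot.lift p h') hxy)

theorem IsWalk.append_right {l₁ l₂ : List (E × Bool)} {b : E × Bool}
    (h : G.IsWalk x y (l₁ ++ b :: l₂)) : G.IsWalk (G.tail b) y (b :: l₂) := by
  induction l₁ generalizing x with
  | nil => exact ⟨rfl, h.2⟩
  | cons a l ih => exact ih h.2

theorem IsWalk.isChain {a : E × Bool} (h : G.IsWalk x y (a :: l)) :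
    (a :: l).IsChain (fun a b => G.head a = G.tail b) := by
  induction l generalizing a x with
  | nil => simp
  | cons b l ih =>
    rw [List.isChain_cons_cons]
    exact ⟨h.2.1.symm, ih h.2⟩

theorem IsWalk.head_getLast {a : E × Bool} (h : G.IsWalk x y (a :: l)) :
    G.head ((a :: l).getLast (by simp)) = y := by
  induction l generalizing a x with
  | nil => exact h.2
  | cons b l ih =>
    rw [List.getLast_cons (by simp)]
    exact ih h.2

theorem IsWalk.head_mem {b : E × Bool} (h : G.IsWalk x y l) (hb : b ∈ l) :
    G.head b = y ∨ G.head b ∈ l.map G.tail := by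
  induction l generalizing x with
  | nil => simp at hb
  | cons a l ih =>
    rcases List.mem_cons.1 hb with rfl | hb
    · cases l with
      | nil => exact Or.inl h.2
      | cons c l => exact Or.inr (by simp [← h.2.1])
    · exact (ih h.2 hb).imp_right fun h => by simp only [List.map_cons, List.mem_cons]; exact Or.inr h

theorem isWalk_of_isChain {a : E × Bool}
    (h : (a :: l).IsChain (fun a b => G.head a = G.tail b)) :
    G.IsWalk (G.tail a) (G.head ((a :: l).getLast (by simp))) (a :: l) := by
  induction l generalizing a with
  | nil => exact ⟨rfl, rfl⟩
  | cons b l ih =>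
    rw [List.isChain_cons_cons] at h
    rw [List.getLast_cons (by simp)]
    exact ⟨rfl, h.1 ▸ ih h.2⟩

theorem IsWalk.sum_signed_coboundary (h : G.IsWalk x y l) (φ : N → ℝ) :
    (l.map (signed (G.coboundary φ))).sum = φ x - φ y := by
  induction l generalizing x with
  | nil => simp [show x = y from h]
  | cons a l ih =>
    obtain ⟨rfl, h⟩ := h
    rw [List.map_cons, List.sum_cons, ih h]
    rcases a with ⟨e, _ | _⟩ <;> simp [signed, coboundary, tail, head]

theorem IsOrientedLoop.sum_signed_coboundary (h : G.IsOrientedLoop l) (φ : N → ℝ) :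
    (l.map (signed (G.coboundary φ))).sum = 0 := by
  cases l with
  | nil => simp
  | cons a l =>
    rw [(isWalk_of_isChain h.chain).sum_signed_coboundary,
      h.closed _ (List.getLast?_eq_getLast_of_ne_nil (by simp)) a (by simp), sub_self]

/-- Since no edge is repeated, exactly one term of the sum survives. This is how a violation of KVL
around a loop is detected. -/
theorem sum_signed_ne_zero {v : E → ℝ} {e : E} (hl : (l.map Prod.fst).Nodup)
    (he : e ∈ l.map Prod.fst) (hve : v e ≠ 0) (hv : ∀ f ∈ l.map Prod.fst, f ≠ e → v f = 0) :
    (l.map (signed v)).sum ≠ 0 := by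
  induction l with
  | nil => simp at he
  | cons a l ih =>
    simp only [List.map_cons, List.nodup_cons, List.mem_cons, forall_eq_or_imp,
      List.sum_cons] at hl he hv ⊢
    by_cases hae : a.1 = e
    · have h0 : (l.map (signed v)).sum = 0 := by
        refine List.sum_eq_zero fun r hr => ?_
        obtain ⟨d, hd, rfl⟩ := List.mem_map.1 hr
        have hd' : d.1 ∈ l.map Prod.fst := List.mem_map_of_mem hd
        have := hv.2 _ hd' fun h => hl.1 (by rw [hae, ← h]; exact hd')
        simp [signed, this]
      rw [h0, add_zero]
      subst hae
      unfold signed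
      split_ifs <;> simpa using hve
    · have h0 : signed v a = 0 := by simp [signed, hv.1 hae]
      rw [h0, zero_add]
      exact ih hl.2 (he.resolve_left (Ne.symm hae)) hv.2

/-- If the new starting node already lies on the path, the part before it is cut off; otherwise the
edge is prepended. -/
theorem IsPathIn.cons {a : E × Bool} (ha : a.1 ∈ T) (h : G.IsPathIn T (G.head a) y l) :
    ∃ l', G.IsPathIn T (G.tail a) y l' := by
  by_cases hy : G.tail a = y
  · exact ⟨[], hy, by simp, by simp, by simp, by simp⟩
  by_cases hm : G.tail a ∈ l.map G.tail
  · obtain ⟨b, hb, hab⟩ := List.mem_map.1 hm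
    obtain ⟨l₁, l₂, rfl⟩ := List.append_of_mem hb
    have hs : (b :: l₂).Sublist (l₁ ++ b :: l₂) := List.sublist_append_right _ _
    refine ⟨b :: l₂, hab ▸ h.walk.append_right, fun c hc => h.subset c (hs.subset hc),
      h.nodes_nodup.sublist (hs.map _), fun hc => h.notMem ((hs.map _).subset hc),
      h.edges_nodup.sublist (hs.map _)⟩
  · refine ⟨a :: l, ⟨rfl, h.walk⟩, ?_, ?_, ?_, ?_⟩
    · rintro b (_ | ⟨_, hb⟩)
      exacts [ha, h.subset b hb]
    · rw [List.map_cons, List.nodup_cons]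
      exact ⟨hm, h.nodes_nodup⟩
    · rw [List.map_cons, List.mem_cons, not_or]
      exact ⟨Ne.symm hy, h.notMem⟩
    · rw [List.map_cons, List.nodup_cons]
      refine ⟨fun hc => ?_, h.edges_nodup⟩
      -- If the edge of `a` recurred in `l`, in either orientation, both of its endpoints would be
      -- nodes of the path, contrary to `hm` and `hy`.
      obtain ⟨b, hb, hab⟩ := List.mem_map.1 hc
      have h1 : G.tail b ∈ l.map G.tail := List.mem_map_of_mem hb
      have h2 := h.walk.head_mem hb
      rcases a with ⟨e, _ | _⟩ <;> rcases b with ⟨f, _ | _⟩ <;> simp only at hab <;> subst hab <;>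
        simp only [tail, head] at h1 h2 hm hy
      · exact hm h1
      · exact h2.elim hy hm
      · exact h2.elim hy hm
      · exact hm h1

theorem exists_isPathIn (h : G.component T x = G.component T y) : ∃ l, G.IsPathIn T x y l := by
  refine (iff_of_component_eq (p := fun z => ∃ l, G.IsPathIn T z y l) (fun e he => ?_) h).2
    ⟨[], rfl, by simp, by simp, by simp, by simp⟩
  exact ⟨fun ⟨l, hl⟩ => IsPathIn.cons (a := (e, false)) he hl,
    fun ⟨l, hl⟩ => IsPathIn.cons (a := (e, true)) he hl⟩

theorem IsPathIn.isOrientedLoop {e : E} (he : e ∉ T) (h : G.IsPathIn T (G.neg e) (G.pos e) l) :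
    G.IsOrientedLoop ((e, true) :: l) := by
  have hw : G.IsWalk (G.pos e) (G.pos e) ((e, true) :: l) := ⟨rfl, h.walk⟩
  refine ⟨by simp, hw.isChain, fun a ha b hb => ?_, ?_, ?_⟩
  · rw [List.getLast?_eq_getLast_of_ne_nil (by simp)] at ha
    obtain rfl : _ = a := by simpa using ha
    obtain rfl : _ = b := by simpa using hb
    exact hw.head_getLast
  · rw [List.map_cons, List.nodup_cons]
    exact ⟨h.notMem, h.nodes_nodup⟩
  · rw [List.map_cons, List.nodup_cons]
    refine ⟨fun hc => ?_, h.edges_nodup⟩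
    obtain ⟨b, hb, hab⟩ := List.mem_map.1 hc
    have hbT := h.subset b hb
    rw [hab] at hbT
    exact he hbT

theorem ContainsLoop.mono (h : G.ContainsLoop T) (hT : T ⊆ T') : G.ContainsLoop T' := by
  obtain ⟨C, hC, hl⟩ := h
  exact ⟨C, hC.trans hT, hl⟩

theorem containsLoop_insert {e : E} (he : e ∉ T)
    (h : G.component T (G.pos e) = G.component T (G.neg e)) : G.ContainsLoop (insert e T) := by
  obtain ⟨l, hl⟩ := exists_isPathIn h.symm
  refine ⟨_, ?_, _, hl.isOrientedLoop he, rfl⟩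
  intro f hf
  rcases List.mem_cons.1 (show f ∈ e :: l.map Prod.fst from hf) with rfl | hf
  · exact Set.mem_insert _ _
  · obtain ⟨b, hb, rfl⟩ := List.mem_map.1 hf
    exact Set.mem_insert_of_mem _ (hl.subset b hb)

/-! ### Component indicators and potentials. -/

open Classical in
/-- The indicator function of the component of `x`. -/
noncomputable def componentIndicator (G : DiGraph N E) (T : Set E) (x : N) (y : N) : ℝ :=
  if G.component T y = G.component T x then 1 else 0

theorem coboundary_componentIndicator {e : E} (he : e ∈ T) :
    G.coboundary (G.componentIndicator T x) e = 0 := by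
  rw [coboundary, sub_eq_zero]
  unfold componentIndicator
  rw [component_pos_eq he]

theorem coboundary_componentIndicator_pos {e : E}
    (h : G.component T (G.pos e) ≠ G.component T (G.neg e)) :
    G.coboundary (G.componentIndicator T (G.pos e)) e = 1 := by
  simp [coboundary, componentIndicator, h.symm]

/-- The loop must use `e`. If `e` joined two components of `T`, the indicator of one of them would
be a potential that changes along `e` only, so its differences could not sum to zero around the
loop. -/
theorem component_eq_of_containsLoop_insert {e : E} (hT : ¬ G.ContainsLoop T)
    (h : G.ContainsLoop (insert e T)) : G.component T (G.pos e) = G.component T (G.neg e) := by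
  by_contra hne
  obtain ⟨C, hC, l, hl, rfl⟩ := h
  have he : e ∈ l.map Prod.fst := by
    by_contra hel
    refine hT ⟨_, fun f hf => ?_, l, hl, rfl⟩
    exact (hC hf).resolve_left fun hfe => hel (hfe ▸ hf)
  refine sum_signed_ne_zero (v := G.coboundary (G.componentIndicator T (G.pos e)))
    hl.edges_nodup he ?_ ?_ (hl.sum_signed_coboundary _)
  · rw [coboundary_componentIndicator_pos hne]
    exact one_ne_zero
  · intro f hf hfe
    exact coboundary_componentIndicator ((hC hf).resolve_left hfe)

/-- A function on the edges that sums to zero around every loop in `T` is a potential difference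
on `T`. -/
theorem exists_coboundary_eq [Finite E] (v : E → ℝ) (T : Set E)
    (h : ∀ l, G.IsOrientedLoop l → (∀ a ∈ l, a.1 ∈ T) → (l.map (signed v)).sum = 0) :
    ∃ φ : N → ℝ, ∀ e ∈ T, G.coboundary φ e = v e := by
  induction T, T.toFinite using Set.Finite.induction_on with
  | empty => exact ⟨0, by simp⟩
  | @insert e T he _ ih =>
    obtain ⟨φ, hφ⟩ := ih fun l hl hT => h l hl fun a ha => Set.mem_insert_of_mem _ (hT a ha)
    by_cases hc : G.component T (G.pos e) = G.component T (G.neg e)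
    · refine ⟨φ, ?_⟩
      obtain ⟨l, hl⟩ := exists_isPathIn hc.symm
      have h0 := h _ (hl.isOrientedLoop he) (by
        intro a ha
        rcases List.mem_cons.1 ha with rfl | ha
        · exact Set.mem_insert _ _
        · exact Set.mem_insert_of_mem _ (hl.subset a ha))
      have h1 : l.map (signed v) = l.map (signed (G.coboundary φ)) :=
        List.map_congr_left fun a ha => by simp [signed, hφ _ (hl.subset a ha)]
      rw [List.map_cons, List.sum_cons, h1, hl.walk.sum_signed_coboundary] at h0
      simp only [signed, if_true] at h0
      rintro f (rfl | hf)
      · simp only [coboundary]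
        linarith
      · exact hφ f hf
    -- Otherwise shifting the potential on one component adjusts the value at `e` and changes
    -- nothing on `T`.
    · refine ⟨φ + (v e - G.coboundary φ e) • G.componentIndicator T (G.pos e), ?_⟩
      have hadd : ∀ f, G.coboundary
          (φ + (v e - G.coboundary φ e) • G.componentIndicator T (G.pos e)) f =
          G.coboundary φ f + (v e - G.coboundary φ e) *
            G.coboundary (G.componentIndicator T (G.pos e)) f := by
        intro f
        simp only [coboundary, Pi.add_apply, Pi.smul_apply, smul_eq_mul]
        ring
      rintro f (rfl | hf)
      · rw [hadd, coboundary_componentIndicator_pos hc]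
        ring
      · rw [hadd, coboundary_componentIndicator hf, hφ f hf]
        ring

/-! ### Kirchhoff's laws in terms of potentials. -/

theorem mem_kvl_iff [Finite E] {v : E → ℝ} : v ∈ G.kvl ↔ ∃ φ : N → ℝ, G.coboundary φ = v := by
  constructor
  · intro h
    obtain ⟨φ, hφ⟩ := exists_coboundary_eq v Set.univ fun l hl _ => h l hl
    exact ⟨φ, funext fun e => hφ e trivial⟩
  · rintro ⟨φ, rfl⟩ l hl
    exact hl.sum_signed_coboundary φ

theorem exists_coboundary_eq_of_not_containsLoop [Finite E] (hT : ¬ G.ContainsLoop T)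
    (v : E → ℝ) : ∃ φ : N → ℝ, ∀ e ∈ T, G.coboundary φ e = v e := by
  refine exists_coboundary_eq v T fun l hl hlT => (hT ⟨_, fun e he => ?_, l, hl, rfl⟩).elim
  obtain ⟨a, ha, rfl⟩ := List.mem_map.1 he
  exact hlT a ha

-- Summation by parts over the nodes; testing with the indicator of a node recovers the current law
-- there.
open Classical in
theorem mem_kcl_iff [Finite N] [Fintype E] {i : E → ℝ} :
    i ∈ G.kcl ↔ ∀ φ : N → ℝ, ∑ e, i e * G.coboundary φ e = 0 := by
  have := Fintype.ofFinite N
  have key : ∀ φ : N → ℝ, ∑ e, i e * G.coboundary φ e =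
      ∑ n, φ n * ((∑ e with G.pos e = n, i e) - ∑ e with G.neg e = n, i e) := by
    intro φ
    simp only [coboundary, mul_sub, Finset.sum_sub_distrib, Finset.mul_sum]
    congr 1
    · rw [← Finset.sum_fiberwise Finset.univ G.pos]
      refine Finset.sum_congr rfl fun n _ => Finset.sum_congr rfl fun e he => ?_
      rw [(Finset.mem_filter.1 he).2, mul_comm]
    · rw [← Finset.sum_fiberwise Finset.univ G.neg]
      refine Finset.sum_congr rfl fun n _ => Finset.sum_congr rfl fun e he => ?_
      rw [(Finset.mem_filter.1 he).2, mul_comm]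
  constructor
  · intro h φ
    rw [key]
    exact Finset.sum_eq_zero fun n _ => by rw [h n, mul_zero]
  · intro h n
    have := h (Pi.single n 1)
    rw [key] at this
    simpa [Pi.single_apply] using this

/-! ### Components and cutsets -/

/-- Adding edges merges components. -/
def componentMap (G : DiGraph N E) (h : T ⊆ T') : Quot (G.Adj T) → Quot (G.Adj T') :=
  Quot.map id fun _ _ ⟨e, he, h'⟩ => ⟨e, h he, h'⟩

theorem componentMap_surjective (h : T ⊆ T') : Function.Surjective (G.componentMap h) := by
  rintro ⟨x⟩
  exact ⟨G.component T x, rfl⟩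

theorem numComponents_anti [Finite N] (h : T ⊆ T') : G.numComponents T' ≤ G.numComponents T :=
  have : Finite (Quot (G.Adj T)) := Quot.finite _
  Nat.card_le_card_of_surjective _ (componentMap_surjective (G := G) h)

theorem component_eq_of_numComponents_eq [Finite N] (h : T ⊆ T')
    (hn : G.numComponents T = G.numComponents T') (hxy : G.component T' x = G.component T' y) :
    G.component T x = G.component T y := by
  have : Finite (Quot (G.Adj T)) := Quot.finite _
  have hb := (Nat.bijective_iff_surjective_and_card (G.componentMap h)).2
    ⟨componentMap_surjective h, hn⟩
  exact hb.1 hxy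

-- Redirecting the component of `G.neg e` to that of `G.pos e` gives a well-defined map from the
-- components of `insert e T`. It can miss only the component of `G.neg e`, which `none` supplies.
open Classical in
theorem numComponents_le_insert [Finite N] (e : E) :
    G.numComponents T ≤ G.numComponents (insert e T) + 1 := by
  have : Finite (Quot (G.Adj (insert e T))) := Quot.finite _
  let g : N → Quot (G.Adj T) := fun x =>
    if G.component T x = G.component T (G.neg e) then G.component T (G.pos e)
    else G.component T x
  have hg : ∀ x y, G.Adj (insert e T) x y → g x = g y := by
    rintro x y ⟨f, rfl | hf, rfl, rfl⟩
    · simp [g]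
    · simp only [g, component_pos_eq hf]
  let k : Option (Quot (G.Adj (insert e T))) → Quot (G.Adj T) := fun o =>
    o.elim (G.component T (G.neg e)) (Quot.lift g hg)
  have hk : Function.Surjective k := by
    rintro ⟨x⟩
    by_cases hx : G.component T x = G.component T (G.neg e)
    · exact ⟨none, hx.symm⟩
    · exact ⟨some (G.component _ x), if_neg hx⟩
  have := Nat.card_le_card_of_surjective k hk
  rwa [Finite.card_option] at this

/-- If deleting `B` increased the number of components, a minimal `D ⊆ B` whose deletion does so
would be a cutset: restoring one edge of `D` undoes the increase, and one edge changes the number by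
at most one. -/
theorem component_eq_of_not_containsCutset [Finite N] [Finite E] {B : Set E}
    (hB : ¬ G.ContainsCutset B) (e : E) :
    G.component Bᶜ (G.pos e) = G.component Bᶜ (G.neg e) := by
  refine component_eq_of_numComponents_eq (Set.subset_univ _) ?_ (component_pos_eq trivial)
  refine le_antisymm ?_ (numComponents_anti (Set.subset_univ _))
  by_contra! hlt
  obtain ⟨D, hDB, hD⟩ := Set.Finite.exists_le_minimal
    (s := {D : Set E | G.numComponents Set.univ < G.numComponents Dᶜ}) (Set.toFinite _) hlt
  refine hB ⟨D, hDB, ?_, fun D' hD' hle => hD.2 ?_ hle⟩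
  · have hne : D.Nonempty := by
      rw [Set.nonempty_iff_ne_empty]
      rintro rfl
      simpa using hD.1
    obtain ⟨f, hf⟩ := hne
    have h1 : G.numComponents (D \ {f})ᶜ ≤ G.numComponents Set.univ := by
      by_contra! h
      exact (hD.2 (show D \ {f} ∈ _ from h) Set.sdiff_subset hf).2 rfl
    have h2 := numComponents_le_insert (G := G) (T := Dᶜ) f
    have h3 : (D \ {f})ᶜ = insert f Dᶜ := by
      ext a
      by_cases a = f <;> simp_all
    have h4 : G.numComponents Set.univ < G.numComponents Dᶜ := hD.1
    rw [h3] at h1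
    omega
  · have h5 : G.numComponents D'ᶜ = G.numComponents Set.univ + 1 := hD'
    exact show G.numComponents Set.univ < G.numComponents D'ᶜ by omega

theorem IsCutset.exists_coboundary [Finite N] {C : Set E} (hC : G.IsCutset C) :
    ∃ (φ : N → ℝ) (e : E), e ∈ C ∧ G.coboundary φ e ≠ 0 ∧ ∀ f ∉ C, G.coboundary φ f = 0 := by
  by_contra! hcon
  have hn : G.numComponents Cᶜ = G.numComponents Set.univ + 1 := hC.1
  -- If no component indicator of `Cᶜ` changed along an edge of `C`, deleting `C` would separate
  -- nothing, contrary to the count.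
  have hinj : Function.Injective (G.componentMap (Set.subset_univ Cᶜ)) := by
    rintro ⟨x⟩ ⟨y⟩ (hxy : G.component Set.univ x = G.component Set.univ y)
    have h0 : ∀ e, G.coboundary (G.componentIndicator Cᶜ y) e = 0 := by
      intro e
      by_cases he : e ∈ C
      · by_contra h1
        obtain ⟨f, hf, hf'⟩ := hcon _ e he h1
        exact hf' (coboundary_componentIndicator hf)
      · exact coboundary_componentIndicator he
    have h1 := (iff_of_component_eq (p := fun z => G.componentIndicator Cᶜ y z = 1)
      (fun e _ => by rw [sub_eq_zero.1 (h0 e)]) hxy).2 (by simp [componentIndicator])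
    by_contra h2
    simp [componentIndicator, show G.component Cᶜ x ≠ G.component Cᶜ y from h2] at h1
  have : Finite (Quot (G.Adj Set.univ)) := Quot.finite _
  have := Nat.card_le_card_of_injective _ hinj
  change G.numComponents Cᶜ ≤ G.numComponents Set.univ at this
  omega

/-! ### Trees -/

theorem IsTree.component_eq {t : Set E} (ht : G.IsTree t) (e : E) :
    G.component t (G.pos e) = G.component t (G.neg e) := by
  by_cases he : e ∈ t
  · exact component_pos_eq he
  · refine component_eq_of_containsLoop_insert ht.1 ?_
    by_contra h
    exact he (ht.2 h (Set.subset_insert _ _) (Set.mem_insert _ _))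

/-- Take `t` maximal among loop-free sets that contain `A` and avoid `B`. It joins the endpoints of
every edge outside `B`; as deleting `B` disconnects nothing, it joins those of every edge, so any
further edge closes a loop. -/
theorem exists_isTree [Finite N] [Finite E] {A B : Set E} (hA : ¬ G.ContainsLoop A)
    (hB : ¬ G.ContainsCutset B) (hAB : Disjoint A B) :
    ∃ t, G.IsTree t ∧ A ⊆ t ∧ Disjoint t B := by
  obtain ⟨t, hAt, ht⟩ := Set.Finite.exists_le_maximal
    (s := {T : Set E | ¬ G.ContainsLoop T ∧ Disjoint T B}) (Set.toFinite _)
    (show A ∈ _ from ⟨hA, hAB⟩)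
  obtain ⟨ht1, ht2⟩ := ht.1
  refine ⟨t, ⟨ht1, fun T hT htT e he => ?_⟩, hAt, ht2⟩
  by_contra het
  have hconn : ∀ f ∈ Bᶜ, G.component t (G.pos f) = G.component t (G.neg f) := by
    intro f hf
    by_cases hft : f ∈ t
    · exact component_pos_eq hft
    refine component_eq_of_containsLoop_insert ht1 ?_
    by_contra h
    refine hft (ht.2 (y := insert f t) ⟨h, ?_⟩ (Set.subset_insert _ _) (Set.mem_insert _ _))
    rw [Set.disjoint_insert_left]
    exact ⟨hf, ht2⟩
  have h := (iff_of_component_eq (p := fun z => G.component t z = G.component t (G.neg e))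
    (fun f hf => by rw [hconn f hf]) (component_eq_of_not_containsCutset hB e)).2 rfl
  exact hT ((containsLoop_insert het h).mono (Set.insert_subset he htT))

open Classical in
/-- Every voltage is an integer combination of the tree voltages. -/
theorem IsTree.exists_int_combination [Fintype E] {t : Set E} (ht : G.IsTree t) :
    ∃ Q : E → E → ℤ, (∀ e, ∀ f ∉ t, Q e f = 0) ∧
      (∀ e ∈ t, ∀ f, Q e f = if f = e then 1 else 0) ∧
      ∀ (φ : N → ℝ) (e : E), G.coboundary φ e = ∑ f, (Q e f : ℝ) * G.coboundary φ f := by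
  have key : ∀ e, ∃ q : E → ℤ, (∀ f ∉ t, q f = 0) ∧
      (e ∈ t → ∀ f, q f = if f = e then 1 else 0) ∧
      ∀ φ : N → ℝ, G.coboundary φ e = ∑ f, (q f : ℝ) * G.coboundary φ f := by
    intro e
    by_cases he : e ∈ t
    · refine ⟨fun f => if f = e then 1 else 0, fun f hf => if_neg fun h : f = e => hf (h ▸ he),
        fun _ _ => rfl, fun φ => by simp⟩
    -- The potential relative to `G.neg e` is propagated along tree edges, each contributing its
    -- voltage with coefficient `±1`.
    have hq := (iff_of_component_eq (p := fun z => ∃ q : E → ℤ, (∀ f ∉ t, q f = 0) ∧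
      ∀ φ : N → ℝ, φ z - φ (G.neg e) = ∑ f, (q f : ℝ) * G.coboundary φ f) ?_
      (ht.component_eq e)).2 ⟨0, by simp, by simp⟩
    · obtain ⟨q, h1, h2⟩ := hq
      exact ⟨q, h1, fun h => (he h).elim, h2⟩
    · intro e' he'
      have hstep : ∀ (s : ℤ) (q : E → ℤ) (φ : N → ℝ),
          ∑ f, ((q f + s * (if f = e' then 1 else 0) : ℤ) : ℝ) * G.coboundary φ f =
            ∑ f, (q f : ℝ) * G.coboundary φ f + s * G.coboundary φ e' := by
        intro s q φ
        push_cast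
        simp [add_mul, Finset.sum_add_distrib]
      constructor
      · rintro ⟨q, h1, h2⟩
        refine ⟨fun f => q f + (-1) * (if f = e' then 1 else 0), fun f hf => ?_, fun φ => ?_⟩
        · simp [h1 f hf, show f ≠ e' from fun h => hf (h ▸ he')]
        · rw [hstep, ← h2 φ, coboundary]
          push_cast
          ring
      · rintro ⟨q, h1, h2⟩
        refine ⟨fun f => q f + 1 * (if f = e' then 1 else 0), fun f hf => ?_, fun φ => ?_⟩
        · simp [h1 f hf, show f ≠ e' from fun h => hf (h ▸ he')]
        · rw [hstep, ← h2 φ, coboundary]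
          push_cast
          ring
  choose Q h1 h2 h3 using key
  exact ⟨Q, h1, h2, fun φ e => h3 e φ⟩

end Multiport.DiGraph

namespace Multiport

/-! ### Parametrization of Kirchhoff's laws by a tree -/

/-- `v = A x`, `i = B x` parametrizes the voltages and currents satisfying Kirchhoff's laws by the
voltages of the edges in `t` and the currents of the edges outside of `t`. -/
structure IsTreeParametrization {N E : Type*} [Fintype E] (G : DiGraph N E) (t : Set E)
    (A B : Matrix E E ℝ) : Prop where
  volt_apply : ∀ x, ∀ e ∈ t, (A.mulVec x) e = x e
  curr_apply : ∀ x, ∀ e ∉ t, (B.mulVec x) e = x e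
  volt_eq_zero : ∀ x, (∀ e ∈ t, x e = 0) → A.mulVec x = 0
  curr_eq_zero : ∀ x, (∀ e ∉ t, x e = 0) → B.mulVec x = 0
  kirchhoff : ∀ v i, v ∈ G.kvl ∧ i ∈ G.kcl ↔ ∃ x, v = A.mulVec x ∧ i = B.mulVec x

-- `A` expresses voltages by tree voltages. Orthogonality dictates `B`: its tree-by-cotree block is
-- minus the transpose of the cotree-by-tree block of `A`. Kirchhoff's laws then become the
-- fixed-point conditions `A v = v` and `B i = i`.
open Classical in
theorem DiGraph.IsTree.exists_isTreeParametrization {N E : Type*} [Finite N] [Fintype E]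
    {G : DiGraph N E} {t : Set E} (ht : G.IsTree t) :
    ∃ A B : Matrix E E ℤ,
      IsTreeParametrization G t (A.map (Int.cast : ℤ → ℝ)) (B.map (Int.cast : ℤ → ℝ)) := by
  obtain ⟨Q, hQ, hQt, hQφ⟩ := ht.exists_int_combination
  let A : Matrix E E ℤ := Matrix.of Q
  let B : Matrix E E ℤ := Matrix.of fun e f =>
    if e ∈ t then (if f ∈ t then 0 else -Q f e) else if f = e then 1 else 0
  have hA : ∀ x e, ((A.map (Int.cast : ℤ → ℝ)).mulVec x) e = ∑ f, (Q e f : ℝ) * x f :=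
    fun x e => rfl
  have hB : ∀ x, ∀ e ∈ t, ((B.map (Int.cast : ℤ → ℝ)).mulVec x) e =
      ∑ f, if f ∈ t then 0 else -((Q f e : ℝ) * x f) := by
    intro x e he
    refine Finset.sum_congr rfl fun f _ => ?_
    simp only [B, Matrix.map_apply, Matrix.of_apply, he, if_true]
    split_ifs <;> simp
  have hA1 : ∀ x, ∀ e ∈ t, ((A.map (Int.cast : ℤ → ℝ)).mulVec x) e = x e := by
    intro x e he
    simp [hA, hQt e he]
  have hB1 : ∀ x, ∀ e ∉ t, ((B.map (Int.cast : ℤ → ℝ)).mulVec x) e = x e := by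
    intro x e he
    simp [B, Matrix.mulVec, dotProduct, he]
  have hA2 : ∀ x y : E → ℝ, (∀ e ∈ t, x e = y e) →
      (A.map (Int.cast : ℤ → ℝ)).mulVec x = (A.map (Int.cast : ℤ → ℝ)).mulVec y := by
    intro x y hxy
    funext e
    rw [hA, hA]
    refine Finset.sum_congr rfl fun f _ => ?_
    by_cases hf : f ∈ t
    · rw [hxy f hf]
    · simp [hQ e f hf]
  have hB2 : ∀ x y : E → ℝ, (∀ e ∉ t, x e = y e) →
      (B.map (Int.cast : ℤ → ℝ)).mulVec x = (B.map (Int.cast : ℤ → ℝ)).mulVec y := by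
    intro x y hxy
    funext e
    by_cases he : e ∈ t
    · rw [hB _ _ he, hB _ _ he]
      refine Finset.sum_congr rfl fun f _ => ?_
      split_ifs with hf
      · rfl
      · rw [hxy f hf]
    · rw [hB1 _ _ he, hB1 _ _ he, hxy e he]
  have hkvl : ∀ v, v ∈ G.kvl ↔ (A.map (Int.cast : ℤ → ℝ)).mulVec v = v := by
    intro v
    rw [DiGraph.mem_kvl_iff]
    constructor
    · rintro ⟨φ, rfl⟩
      exact funext fun e => (hQφ φ e).symm
    · intro h
      obtain ⟨φ, hφ⟩ := DiGraph.exists_coboundary_eq_of_not_containsLoop ht.1 v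
      refine ⟨φ, ?_⟩
      rw [← h, ← hA2 _ _ hφ]
      exact funext fun e => hQφ φ e
  -- The coefficient of the tree voltage at `f` in the pairing of `i` with a potential difference;
  -- tree voltages being arbitrary, it must vanish under KCL.
  have hsplit : ∀ (i : E → ℝ), ∀ f ∈ t, ∑ e, i e * Q e f =
      i f - ((B.map (Int.cast : ℤ → ℝ)).mulVec i) f := by
    intro i f hf
    rw [hB _ _ hf, eq_sub_iff_add_eq, ← Finset.sum_add_distrib]
    have : ∀ e, (i e * Q e f + if e ∈ t then 0 else -((Q e f : ℝ) * i e)) =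
        if e = f then i e else 0 := by
      intro e
      by_cases he : e ∈ t
      · rw [hQt e he]
        by_cases hef : e = f
        · simp [hef, hf]
        · simp [he, hef, Ne.symm hef]
      · have hef : e ≠ f := fun h => he (h ▸ hf)
        simp only [he, hef, if_false]
        ring
    simp [this]
  have hkcl : ∀ i, i ∈ G.kcl ↔ (B.map (Int.cast : ℤ → ℝ)).mulVec i = i := by
    intro i
    rw [DiGraph.mem_kcl_iff]
    have key : ∀ φ : N → ℝ, ∑ e, i e * G.coboundary φ e =
        ∑ f, (∑ e, i e * Q e f) * G.coboundary φ f := by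
      intro φ
      have : ∀ e, i e * G.coboundary φ e = ∑ f, i e * Q e f * G.coboundary φ f := by
        intro e
        rw [hQφ φ e, Finset.mul_sum]
        simp only [mul_assoc]
      simp only [this]
      rw [Finset.sum_comm]
      simp only [Finset.sum_mul]
    constructor
    · intro h
      funext f
      by_cases hf : f ∈ t
      · obtain ⟨φ, hφ⟩ := DiGraph.exists_coboundary_eq_of_not_containsLoop ht.1
          (Pi.single f (1 : ℝ))
        have h0 := h φ
        rw [key, Finset.sum_eq_single f] at h0
        · rw [hφ f hf, hsplit i f hf] at h0
          simp only [Pi.single_eq_same, mul_one] at h0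
          linarith
        · intro e _ hef
          by_cases he : e ∈ t
          · rw [hφ e he, Pi.single_eq_of_ne hef, mul_zero]
          · simp [hQ _ _ he]
        · simp
      · exact hB1 _ _ hf
    · intro h φ
      rw [key]
      refine Finset.sum_eq_zero fun f _ => ?_
      by_cases hf : f ∈ t
      · rw [hsplit i f hf, h, sub_self, zero_mul]
      · simp [hQ _ _ hf]
  refine ⟨A, B, hA1, hB1, fun x hx => ?_, fun x hx => ?_, fun v i => ?_⟩
  · rw [hA2 x 0 hx, Matrix.mulVec_zero]
  · rw [hB2 x 0 hx, Matrix.mulVec_zero]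
  · rw [hkvl, hkcl]
    constructor
    · rintro ⟨hv, hi⟩
      refine ⟨fun e => if e ∈ t then v e else i e, ?_, ?_⟩
      · rw [← hA2 v _ fun e he => (if_pos he).symm, hv]
      · rw [← hB2 i _ fun e he => (if_neg he).symm, hi]
    · rintro ⟨x, rfl, rfl⟩
      exact ⟨hA2 _ _ (hA1 x), hB2 _ _ (hB1 x)⟩

/-! ### Column bases and hybrid representations -/

section Hybrid

theorem IsRepresentativeMatrix.finrank_eq {X : Type*} {n : ℕ} {B : Matrix (Fin n) X ℝ}
    {W : Submodule ℝ (X → ℝ)} (h : IsRepresentativeMatrix B W) : Module.finrank ℝ W = n := by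
  rw [← h.2, finrank_span_eq_card h.1, Fintype.card_fin]

/-- Pulling back the standard basis of `ℝ^T` gives a basis of `W` whose columns in `T` form an
identity matrix. No larger set is independent, since every representative matrix has `dim W = |T|`
rows. -/
theorem isColumnBase_of_bijective {X : Type*} [Finite X] {W : Submodule ℝ (X → ℝ)} {T : Set X}
    (h : Function.Bijective ((LinearMap.funLeft ℝ ℝ (Subtype.val : T → X)).comp W.subtype)) :
    IsColumnBase W T := by
  classical
  have := Fintype.ofFinite X
  have := Fintype.ofFinite T
  let e := LinearEquiv.ofBijective _ h
  let σ := Fintype.equivFin T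
  let b : Module.Basis (Fin (Fintype.card T)) ℝ W :=
    ((Pi.basisFun ℝ T).map e.symm).reindex σ
  let B : Matrix (Fin (Fintype.card T)) X ℝ := Matrix.of fun k => (b k : X → ℝ)
  have hrow : B.row = W.subtype ∘ b := rfl
  have hfin : Module.finrank ℝ W = Fintype.card T := by
    rw [Module.finrank_eq_card_basis b, Fintype.card_fin]
  refine ⟨⟨_, B, ⟨?_, ?_⟩, ?_⟩, ?_⟩
  · rw [hrow]
    exact b.linearIndependent.map' _ (Submodule.ker_subtype W)
  · rw [hrow, Set.range_comp, ← Submodule.map_span, b.span_eq, Submodule.map_subtype_top]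
  · have hcol : (fun τ : T => B.col τ) = Pi.basisFun ℝ (Fin (Fintype.card T)) ∘ σ := by
      funext τ k
      have h1 : e (b k) = Pi.basisFun ℝ T (σ.symm k) := by simp [b]
      have h2 : (b k : X → ℝ) τ = Pi.basisFun ℝ T (σ.symm k) τ := by
        rw [← h1]
        rfl
      change (b k : X → ℝ) τ = _
      rw [h2]
      rw [Pi.basisFun_apply, Function.comp_apply, Pi.basisFun_apply, Pi.single_apply,
        Pi.single_apply]
      simp only [Equiv.eq_symm_apply, eq_comm]
    change LinearIndependent ℝ (fun τ : T => B.col τ)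
    rw [hcol]
    exact (Pi.basisFun ℝ _).linearIndependent.comp _ σ.injective
  · rintro T' ⟨n, B', hB', hT'⟩ hTT'
    have := Fintype.ofFinite T'
    have h1 := hT'.linearIndependent.fintype_card_le_finrank
    rw [Module.finrank_fin_fun, ← hB'.finrank_eq, hfin] at h1
    have h2 : T = T' := by
      refine Set.eq_of_subset_of_ncard_le hTT' ?_ (Set.toFinite _)
      rwa [← Set.fintypeCard_eq_ncard, ← Set.fintypeCard_eq_ncard]
    exact h2.ge

variable {P : Type*} {P₁ : Set P}

open Classical in
/-- The vector with prescribed `(v_{P₁}, i_{P₂})` and `(i_{P₁}, v_{P₂})`. -/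
noncomputable def hybridVector (P₁ : Set P) (y z : P → ℝ) : P ⊕ P → ℝ :=
  Sum.elim (fun p => if p ∈ P₁ then y p else z p) (fun p => if p ∈ P₁ then z p else y p)

open Classical in
theorem hybridVector_eq (f : P ⊕ P → ℝ) :
    hybridVector P₁ (fun p => if p ∈ P₁ then volt f p else curr f p)
      (fun p => if p ∈ P₁ then curr f p else volt f p) = f := by
  funext a
  rcases a with p | p <;> by_cases hp : p ∈ P₁ <;>
    simp [hybridVector, hp, volt, curr, LinearMap.funLeft_apply]

theorem hybridVector_add (y z y' z' : P → ℝ) :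
    hybridVector P₁ y z + hybridVector P₁ y' z' = hybridVector P₁ (y + y') (z + z') := by
  funext a
  rcases a with p | p <;> by_cases hp : p ∈ P₁ <;> simp [hybridVector, hp]

variable [Fintype P]

open Classical in
/-- The affine space `A` is the solution set of `(i_{P₁}, v_{P₂}) = H (v_{P₁}, i_{P₂}) + s`, where
the rows and columns of `H` are indexed by the ports. -/
def IsHybridForm (A : AffineSubspace ℝ (P ⊕ P → ℝ)) (P₁ : Set P) (H : Matrix P P ℝ)
    (s : P → ℝ) : Prop :=
  ∀ f, f ∈ A ↔ (fun p => if p ∈ P₁ then curr f p else volt f p) =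
    H.mulVec (fun p => if p ∈ P₁ then volt f p else curr f p) + s

variable {A : AffineSubspace ℝ (P ⊕ P → ℝ)} {H : Matrix P P ℝ} {s : P → ℝ}

open Classical in
theorem IsHybridForm.hasHybridRepresentation (h : IsHybridForm A P₁ H s) :
    HasHybridRepresentation A P₁ := by
  refine ⟨H.submatrix (↑) (↑), H.submatrix (↑) (↑), H.submatrix (↑) (↑), H.submatrix (↑) (↑),
    Sum.elim (fun p => s p) (fun p => s p), fun f => ?_⟩
  have hsum : ∀ p, H.mulVec (fun p => if p ∈ P₁ then volt f p else curr f p) p =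
      ∑ q : P₁, H p q * volt f q + ∑ q : ↥P₁ᶜ, H p q * curr f q := by
    intro p
    rw [Matrix.mulVec, dotProduct, ← Equiv.sum_comp (Equiv.Set.sumCompl P₁), Fintype.sum_sum_type]
    congr 1
    · refine Finset.sum_congr rfl fun q _ => ?_
      simp
    · refine Finset.sum_congr rfl fun q _ => ?_
      simp [show (q : P) ∉ P₁ from q.2]
  rw [h f, funext hsum, Matrix.fromBlocks_mulVec, funext_iff, funext_iff]
  simp only [Pi.add_apply, Sum.forall, Sum.elim_inl, Sum.elim_inr, Matrix.mulVec, dotProduct,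
    Matrix.submatrix_apply, Function.comp_def]
  constructor
  · intro h'
    refine ⟨fun p => ?_, fun p => ?_⟩
    · simpa using h' p
    · simpa [show (p : P) ∉ P₁ from p.2] using h' p
  · rintro ⟨h1, h2⟩ p
    by_cases hp : p ∈ P₁
    · simpa [hp] using h1 ⟨p, hp⟩
    · simpa [hp] using h2 ⟨p, hp⟩

open Classical in
theorem IsHybridForm.hybridVector_mem (h : IsHybridForm A P₁ H s) {y z : P → ℝ} :
    hybridVector P₁ y z ∈ A ↔ z = H.mulVec y + s := by
  have h1 : (fun p => if p ∈ P₁ then volt (hybridVector P₁ y z) p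
      else curr (hybridVector P₁ y z) p) = y := by
    funext p
    by_cases hp : p ∈ P₁ <;> simp [hybridVector, hp, volt, curr, LinearMap.funLeft_apply]
  have h2 : (fun p => if p ∈ P₁ then curr (hybridVector P₁ y z) p
      else volt (hybridVector P₁ y z) p) = z := by
    funext p
    by_cases hp : p ∈ P₁ <;> simp [hybridVector, hp, volt, curr, LinearMap.funLeft_apply]
  rw [h, h1, h2]

theorem IsHybridForm.hybridVector_mem_direction (h : IsHybridForm A P₁ H s) {y z : P → ℝ} :
    hybridVector P₁ y z ∈ A.direction ↔ z = H.mulVec y := by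
  -- The point with zero inputs serves as origin.
  have h0 : hybridVector P₁ 0 s ∈ A := h.hybridVector_mem.2 (by simp)
  rw [← AffineSubspace.vadd_mem_iff_mem_direction _ h0, vadd_eq_add, hybridVector_add,
    h.hybridVector_mem, add_zero, add_left_inj]

-- The direction is the graph of `H` over `(v_{P₁}, i_{P₂})`, so restricting to these coordinates is
-- bijective.
open Classical in
theorem IsHybridForm.isColumnBase (h : IsHybridForm A P₁ H s) :
    IsColumnBase A.direction (Sum.inl '' P₁ ∪ Sum.inr '' P₁ᶜ) := by
  have hv : ∀ f, f ∈ A.direction → ∃ y, f = hybridVector P₁ y (H.mulVec y) := by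
    intro f hf
    rw [← hybridVector_eq (P₁ := P₁) f] at hf
    refine ⟨fun p => if p ∈ P₁ then volt f p else curr f p, ?_⟩
    rw [← h.hybridVector_mem_direction.1 hf, hybridVector_eq]
  refine isColumnBase_of_bijective ⟨?_, fun y => ?_⟩
  · rw [← LinearMap.ker_eq_bot, LinearMap.ker_eq_bot']
    rintro ⟨f, hf⟩ h0
    obtain ⟨y, rfl⟩ := hv f hf
    have hy : y = 0 := by
      funext p
      by_cases hp : p ∈ P₁
      · have := congrFun h0 ⟨Sum.inl p, Or.inl ⟨p, hp, rfl⟩⟩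
        simpa [LinearMap.funLeft_apply, hybridVector, hp] using this
      · have := congrFun h0 ⟨Sum.inr p, Or.inr ⟨p, hp, rfl⟩⟩
        simpa [LinearMap.funLeft_apply, hybridVector, hp] using this
    subst hy
    refine Subtype.ext (funext fun a => ?_)
    rcases a with p | p <;> simp [hybridVector]
  · let y' : P → ℝ := fun p => if hp : p ∈ P₁ then y ⟨Sum.inl p, Or.inl ⟨p, hp, rfl⟩⟩
      else y ⟨Sum.inr p, Or.inr ⟨p, hp, rfl⟩⟩
    refine ⟨⟨hybridVector P₁ y' (H.mulVec y'), h.hybridVector_mem_direction.2 rfl⟩, ?_⟩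
    funext a
    rcases a with ⟨_, ⟨p, hp, rfl⟩ | ⟨p, hp, rfl⟩⟩
    · simp [LinearMap.funLeft_apply, hybridVector, hp, y']
    · have hp' : p ∉ P₁ := hp
      simp [LinearMap.funLeft_apply, hybridVector, hp', y']

end Hybrid

end Multiport

namespace Multiport

/-! ### The device equations -/

section Device

variable {CCVS VCCS CCCS VCVS Res VSrc ISrc : Type*}

/-- The left hand sides of the device equations (one for each branch), with all terms brought to the
left except for the values of the independent sources. -/
def Branch.equation {K : Type*} [CommRing K] (c : CCVS ⊕ VCCS ⊕ CCCS ⊕ VCVS ⊕ Res → K)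
    (v i : Branch CCVS VCCS CCCS VCVS Res VSrc ISrc → K) :
    Branch CCVS VCCS CCCS VCVS Res VSrc ISrc → K
  | .ccvsCtrl d => v (.ccvsCtrl d)
  | .ccvsSrc d => v (.ccvsSrc d) - c (.inl d) * i (.ccvsCtrl d)
  | .vccsCtrl d => i (.vccsCtrl d)
  | .vccsSrc d => i (.vccsSrc d) - c (.inr (.inl d)) * v (.vccsCtrl d)
  | .cccsCtrl d => v (.cccsCtrl d)
  | .cccsSrc d => i (.cccsSrc d) - c (.inr (.inr (.inl d))) * i (.cccsCtrl d)
  | .vcvsCtrl d => i (.vcvsCtrl d)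
  | .vcvsSrc d => v (.vcvsSrc d) - c (.inr (.inr (.inr (.inl d)))) * v (.vcvsCtrl d)
  | .resistor d => v (.resistor d) - c (.inr (.inr (.inr (.inr d)))) * i (.resistor d)
  | .vsource d => v (.vsource d)
  | .isource d => i (.isource d)

/-- Allows the equations to be written with indeterminate parameters and specialised afterwards. -/
theorem Branch.map_equation {K L : Type*} [CommRing K] [CommRing L] (F : K →+* L)
    (c : CCVS ⊕ VCCS ⊕ CCCS ⊕ VCVS ⊕ Res → K)
    (v i : Branch CCVS VCCS CCCS VCVS Res VSrc ISrc → K)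
    (b : Branch CCVS VCCS CCCS VCVS Res VSrc ISrc) :
    F (equation c v i b) = equation (F ∘ c) (F ∘ v) (F ∘ i) b := by
  cases b <;> simp [equation]

theorem Branch.sum_equation_mul {K X : Type*} [CommRing K] [Fintype X]
    (c : CCVS ⊕ VCCS ⊕ CCCS ⊕ VCVS ⊕ Res → K)
    (v i : X → Branch CCVS VCCS CCCS VCVS Res VSrc ISrc → K) (x : X → K)
    (b : Branch CCVS VCCS CCCS VCVS Res VSrc ISrc) :
    ∑ e, equation c (v e) (i e) b * x e =
      equation c (fun b => ∑ e, v e b * x e) (fun b => ∑ e, i e b * x e) b := by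
  cases b <;> simp [equation, sub_mul, mul_assoc, Finset.sum_sub_distrib, Finset.mul_sum]

/-- The device equations as a linear map. -/
def Branch.equations (c : CCVS ⊕ VCCS ⊕ CCCS ⊕ VCVS ⊕ Res → ℝ) :
    (Branch CCVS VCCS CCCS VCVS Res VSrc ISrc ⊕ Branch CCVS VCCS CCCS VCVS Res VSrc ISrc → ℝ) →ₗ[ℝ]
      (Branch CCVS VCCS CCCS VCVS Res VSrc ISrc → ℝ) where
  toFun f := equation c (volt f) (curr f)
  map_add' f g := by
    funext b
    cases b <;> simp [equation] <;> ring
  map_smul' a f := by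
    funext b
    cases b <;> simp [equation] <;> ring

theorem Branch.equations_apply (c : CCVS ⊕ VCCS ⊕ CCCS ⊕ VCVS ⊕ Res → ℝ)
    (f : Branch CCVS VCCS CCCS VCVS Res VSrc ISrc ⊕ Branch CCVS VCCS CCCS VCVS Res VSrc ISrc → ℝ) :
    equations c f = equation c (volt f) (curr f) := rfl

variable {p : Parameters CCVS VCCS CCCS VCVS Res VSrc ISrc}

namespace Parameters

/-- The values of the independent sources. -/
def sources (p : Parameters CCVS VCCS CCCS VCVS Res VSrc ISrc) :
    Branch CCVS VCCS CCCS VCVS Res VSrc ISrc → ℝ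
  | .vsource d => p.sE d
  | .isource d => p.sJ d
  | _ => 0

theorem mem_device_iff {f} : f ∈ p.device ↔ Branch.equations p.values f = p.sources := by
  change p.Satisfies f ↔ _
  rw [Branch.equations_apply, funext_iff]
  constructor
  · rintro ⟨h1, h2, h3, h4, h5, h6, h7, h8, h9, h10, h11⟩ (d | d | d | d | d | d | d | d | d | d | d)
    all_goals simp [Branch.equation, sources, values, *]
  · intro h
    constructor <;> intro d
    · exact h (.ccvsCtrl d)
    · exact sub_eq_zero.1 (h (.ccvsSrc d))
    · exact h (.vccsCtrl d)
    · exact sub_eq_zero.1 (h (.vccsSrc d))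
    · exact h (.cccsCtrl d)
    · exact sub_eq_zero.1 (h (.cccsSrc d))
    · exact h (.vcvsCtrl d)
    · exact sub_eq_zero.1 (h (.vcvsSrc d))
    · exact sub_eq_zero.1 (h (.resistor d))
    · exact h (.vsource d)
    · exact h (.isource d)

theorem direction_device : p.device.direction = LinearMap.ker (Branch.equations p.values) := by
  obtain ⟨a, ha⟩ := p.device_nonempty
  ext f
  rw [← AffineSubspace.vadd_mem_iff_mem_direction _ ha, mem_device_iff, vadd_eq_add, map_add,
    mem_device_iff.1 ha, LinearMap.mem_ker, add_eq_right]

end Parameters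

theorem exists_mem_device_iff {N P : Type*} {c : CCVS ⊕ VCCS ⊕ CCCS ⊕ VCVS ⊕ Res → ℝ}
    {M : LinearMultiport N (Branch CCVS VCCS CCCS VCVS Res VSrc ISrc) P}
    (hM : M.device.direction = LinearMap.ker (Branch.equations c)) :
    ∃ s, ∀ f, f ∈ M.device ↔ Branch.equations c f = s := by
  obtain ⟨a, ha⟩ := M.device_nonempty
  refine ⟨Branch.equations c a, fun f => ?_⟩
  rw [← AffineSubspace.vsub_right_mem_direction_iff_mem ha, hM, LinearMap.mem_ker, vsub_eq_sub,
    map_sub, sub_eq_zero]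

/-! ### The network equations -/

theorem eq_of_volt_curr {X : Type*} {f g : X ⊕ X → ℝ} (hv : volt f = volt g)
    (hi : curr f = curr g) : f = g := by
  funext e
  rcases e with e | e
  · exact congrFun hv e
  · exact congrFun hi e

variable {P : Type*}

open Classical in
/-- The matrix of the device equations together with the port variables, for `v = A x`, `i = B x`
as in `IsTreeParametrization`. -/
noncomputable def networkMatrix {K : Type*} [CommRing K] (c : CCVS ⊕ VCCS ⊕ CCCS ⊕ VCVS ⊕ Res → K)
    (A B : Matrix (Branch CCVS VCCS CCCS VCVS Res VSrc ISrc ⊕ P)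
      (Branch CCVS VCCS CCCS VCVS Res VSrc ISrc ⊕ P) K) :
    Matrix (Branch CCVS VCCS CCCS VCVS Res VSrc ISrc ⊕ P)
      (Branch CCVS VCCS CCCS VCVS Res VSrc ISrc ⊕ P) K :=
  Matrix.of fun e f => Sum.elim
    (Branch.equation c (fun b => A (.inl b) f) (fun b => B (.inl b) f))
    (fun q => if f = .inr q then 1 else 0) e

theorem map_networkMatrix {K L : Type*} [CommRing K] [CommRing L] (F : K →+* L)
    (c : CCVS ⊕ VCCS ⊕ CCCS ⊕ VCVS ⊕ Res → K)
    (A B : Matrix (Branch CCVS VCCS CCCS VCVS Res VSrc ISrc ⊕ P)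
      (Branch CCVS VCCS CCCS VCVS Res VSrc ISrc ⊕ P) ℤ) :
    (networkMatrix c (A.map Int.cast) (B.map Int.cast)).map F =
      networkMatrix (F ∘ c) (A.map Int.cast) (B.map Int.cast) := by
  ext e f
  rcases e with b | q
  · simp only [networkMatrix, Matrix.map_apply, Matrix.of_apply, Sum.elim_inl,
      Branch.map_equation]
    simp [Function.comp_def]
  · simp only [networkMatrix, Matrix.map_apply, Matrix.of_apply, Sum.elim_inr]
    split_ifs <;> simp

variable [Fintype CCVS] [Fintype VCCS] [Fintype CCCS] [Fintype VCVS] [Fintype Res] [Fintype VSrc]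
  [Fintype ISrc] [Fintype P]

theorem networkMatrix_mulVec_inl {K : Type*} [CommRing K]
    (c : CCVS ⊕ VCCS ⊕ CCCS ⊕ VCVS ⊕ Res → K)
    (A B : Matrix (Branch CCVS VCCS CCCS VCVS Res VSrc ISrc ⊕ P)
      (Branch CCVS VCCS CCCS VCVS Res VSrc ISrc ⊕ P) K) (x) (b) :
    (networkMatrix c A B).mulVec x (.inl b) =
      Branch.equation c (fun b => A.mulVec x (.inl b)) (fun b => B.mulVec x (.inl b)) b := by
  simp only [Matrix.mulVec, dotProduct, networkMatrix, Matrix.of_apply, Sum.elim_inl]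
  exact Branch.sum_equation_mul c (fun e b => A (.inl b) e) (fun e b => B (.inl b) e) x b

theorem networkMatrix_mulVec_inr {K : Type*} [CommRing K]
    (c : CCVS ⊕ VCCS ⊕ CCCS ⊕ VCVS ⊕ Res → K)
    (A B : Matrix (Branch CCVS VCCS CCCS VCVS Res VSrc ISrc ⊕ P)
      (Branch CCVS VCCS CCCS VCVS Res VSrc ISrc ⊕ P) K) (x) (q) :
    (networkMatrix c A B).mulVec x (.inr q) = x (.inr q) := by
  simp [Matrix.mulVec, dotProduct, networkMatrix]

open Classical in
/-- If the network equations are nonsingular for some values of the parameters, then they are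
nonsingular for algebraically independent ones. -/
theorem det_networkMatrix_ne_zero {c c₀ : CCVS ⊕ VCCS ⊕ CCCS ⊕ VCVS ⊕ Res → ℝ}
    (hc : AlgebraicIndependent ℚ c)
    (A B : Matrix (Branch CCVS VCCS CCCS VCVS Res VSrc ISrc ⊕ P)
      (Branch CCVS VCCS CCCS VCVS Res VSrc ISrc ⊕ P) ℤ)
    (h : (networkMatrix c₀ (A.map Int.cast) (B.map Int.cast)).det ≠ 0) :
    (networkMatrix c (A.map Int.cast) (B.map Int.cast)).det ≠ 0 := by
  let D : MvPolynomial (CCVS ⊕ VCCS ⊕ CCCS ⊕ VCVS ⊕ Res) ℚ :=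
    (networkMatrix MvPolynomial.X (A.map Int.cast) (B.map Int.cast)).det
  have hD : ∀ c' : CCVS ⊕ VCCS ⊕ CCCS ⊕ VCVS ⊕ Res → ℝ, MvPolynomial.aeval c' D =
      (networkMatrix c' (A.map Int.cast) (B.map Int.cast)).det := by
    intro c'
    have h1 := RingHom.map_det (MvPolynomial.aeval (R := ℚ) c' : _ →ₐ[ℚ] ℝ).toRingHom
      (networkMatrix MvPolynomial.X (A.map Int.cast) (B.map Int.cast))
    rw [RingHom.mapMatrix_apply, map_networkMatrix] at h1
    refine h1.trans ?_
    congr 2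
    funext j
    exact MvPolynomial.aeval_X c' j
  rw [← hD] at h ⊢
  intro h0
  -- Algebraic independence is injectivity of evaluation at `c`; a zero polynomial would also vanish
  -- at `c₀`.
  have : D = 0 := hc (by rw [h0, map_zero])
  exact h (by rw [this, map_zero])

end Device

end Multiport

namespace Multiport

/-! ### Nonsingular network equations: properness and hybrid form. -/

section Network

variable {N CCVS VCCS CCCS VCVS Res VSrc ISrc P : Type*} [Fintype CCVS] [Fintype VCCS]
  [Fintype CCCS] [Fintype VCVS] [Fintype Res] [Fintype VSrc] [Fintype ISrc] [Fintype P]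
  {G : DiGraph N (Branch CCVS VCCS CCCS VCVS Res VSrc ISrc ⊕ P)}
  {t : Set (Branch CCVS VCCS CCCS VCVS Res VSrc ISrc ⊕ P)}
  {A B : Matrix (Branch CCVS VCCS CCCS VCVS Res VSrc ISrc ⊕ P)
    (Branch CCVS VCCS CCCS VCVS Res VSrc ISrc ⊕ P) ℝ}
  {c : CCVS ⊕ VCCS ⊕ CCCS ⊕ VCVS ⊕ Res → ℝ}
  {p : Parameters CCVS VCCS CCCS VCVS Res VSrc ISrc}

open Classical in
/-- The network equations are nonsingular when all controlled source parameters are `0`, and the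
resistances are `0` in the tree and `1` outside. -/
theorem IsTreeParametrization.exists_det_ne_zero (hAB : IsTreeParametrization G t A B)
    (h₁ : Z₁ P ∪ Y₁ P ∪ E P ⊆ t) (h₂ : Disjoint t (Z₂ P ∪ Y₂ P ∪ J P)) :
    ∃ c₀ : CCVS ⊕ VCCS ⊕ CCCS ⊕ VCVS ⊕ Res → ℝ, (networkMatrix c₀ A B).det ≠ 0 := by
  let c₀ : CCVS ⊕ VCCS ⊕ CCCS ⊕ VCVS ⊕ Res → ℝ :=
    Sum.elim 0 (Sum.elim 0 (Sum.elim 0 (Sum.elim 0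
      fun d => if (.inl (.resistor d)) ∈ t then 0 else 1)))
  refine ⟨c₀, fun h0 => ?_⟩
  obtain ⟨x, hx0, hx⟩ := Matrix.exists_mulVec_eq_zero_iff.2 h0
  have h₂' : ∀ e ∈ Z₂ P ∪ Y₂ P ∪ J P, e ∉ t := fun e he het => Set.disjoint_left.1 h₂ het he
  have hS : ∀ b, Branch.equation c₀ (fun b => A.mulVec x (.inl b))
      (fun b => B.mulVec x (.inl b)) b = 0 := by
    intro b
    rw [← networkMatrix_mulVec_inl, hx]
    rfl
  have hP : ∀ q, x (.inr q) = 0 := by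
    intro q
    rw [← networkMatrix_mulVec_inr c₀ A B x, hx]
    rfl
  -- At `c₀` every device branch of the tree has an equation that reads `v = 0`.
  have hv : ∀ e ∈ t, x e = 0 := by
    rintro (b | q) he
    · rw [← hAB.volt_apply x _ he]
      have hb := hS b
      rcases b with d | d | d | d | d | d | d | d | d | d | d
      · exact hb
      · simpa [Branch.equation, c₀] using hb
      · exact (h₂' _ (by simp [Y₂]) he).elim
      · exact (h₂' _ (by simp [Z₂]) he).elim
      · exact hb
      · exact (h₂' _ (by simp [Z₂]) he).elim
      · exact (h₂' _ (by simp [Y₂]) he).elim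
      · simpa [Branch.equation, c₀] using hb
      · simpa [Branch.equation, c₀, he] using hb
      · exact hb
      · exact (h₂' _ (by simp [J]) he).elim
    · exact hP q
  have hA := hAB.volt_eq_zero x hv
  have hi : ∀ e ∉ t, x e = 0 := by
    rintro (b | q) he
    · rw [← hAB.curr_apply x _ he]
      have hb := hS b
      rcases b with d | d | d | d | d | d | d | d | d | d | d
      · exact (he (h₁ (by simp [Y₁]))).elim
      · exact (he (h₁ (by simp [Z₁]))).elim
      · exact hb
      · simpa [Branch.equation, c₀] using hb
      · exact (he (h₁ (by simp [Y₁]))).elim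
      · simpa [Branch.equation, c₀] using hb
      · exact hb
      · exact (he (h₁ (by simp [Z₁]))).elim
      -- Outside the tree the resistance is `1`, so `i = v`, and all voltages already vanish.
      · simpa [Branch.equation, c₀, he, hA] using hb
      · exact (he (h₁ (by simp [E]))).elim
      · exact hb
    · exact hP q
  exact hx0 (funext fun e => (Classical.em (e ∈ t)).elim (hv e) (hi e))

theorem IsTreeParametrization.mem_solutions_iff (hAB : IsTreeParametrization G t A B)
    {M : LinearMultiport N (Branch CCVS VCCS CCCS VCVS Res VSrc ISrc) P} (hG : M.graph = G)
    {s} (hs : ∀ f, f ∈ M.device ↔ Branch.equations c f = s) {f} :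
    f ∈ M.solutions ↔ ∃ x, volt f = A.mulVec x ∧ curr f = B.mulVec x ∧
      ∀ b, (networkMatrix c A B).mulVec x (.inl b) = s b := by
  have h1 : f ∈ M.solutions ↔ (volt f ∈ G.kvl ∧ curr f ∈ G.kcl) ∧
      Branch.equations c (restrictS f) = s := by
    rw [← hs, ← hG]
    rfl
  rw [h1, hAB.kirchhoff, ← exists_and_right]
  refine exists_congr fun x => ?_
  rw [and_assoc]
  refine and_congr_right fun hv => and_congr_right fun hi => ?_
  rw [funext_iff]
  refine forall_congr' fun b => ?_
  rw [networkMatrix_mulVec_inl, ← hv, ← hi]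
  rfl

-- Surjectivity of the matrix gives a solution for every translate, injectivity its uniqueness.
-- Surjectivity also makes the device equations independent, so their kernel has dimension `2|S| -
-- |S|`.
open Classical in
theorem IsTreeParametrization.isProper (hAB : IsTreeParametrization G t A B)
    (hdet : (networkMatrix p.values A B).det ≠ 0) : (p.multiport G).IsProper := by
  have hinj := Matrix.mulVec_injective_iff_isUnit.2 ((Matrix.isUnit_iff_isUnit_det _).2 hdet.isUnit)
  have hsurj := Matrix.mulVec_surjective_iff_isUnit.2
    ((Matrix.isUnit_iff_isUnit_det _).2 hdet.isUnit)
  refine ⟨fun M hG hdir => ?_, ?_⟩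
  · obtain ⟨s, hs⟩ := exists_mem_device_iff (hdir.trans Parameters.direction_device)
    refine ⟨?_, ?_⟩
    -- The zero port inputs are an arbitrary choice.
    · obtain ⟨x, hx⟩ := hsurj (Sum.elim s 0)
      refine ⟨Sum.elim (A.mulVec x) (B.mulVec x), (hAB.mem_solutions_iff hG hs).2 ⟨x, rfl, rfl,
        fun b => ?_⟩⟩
      rw [hx, Sum.elim_inl]
    · rintro _ ⟨f, hf, rfl⟩
      refine ⟨f, ⟨hf, rfl⟩, ?_⟩
      rintro g ⟨hg, hgf⟩
      obtain ⟨x, hvx, hix, hx⟩ := (hAB.mem_solutions_iff hG hs).1 hf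
      obtain ⟨y, hvy, hiy, hy⟩ := (hAB.mem_solutions_iff hG hs).1 hg
      have hxy : y = x := by
        refine hinj (funext fun e => ?_)
        rcases e with b | q
        · rw [hx, hy]
        · rw [networkMatrix_mulVec_inr, networkMatrix_mulVec_inr]
          by_cases hq : .inr q ∈ t
          · rw [← hAB.volt_apply y _ hq, ← hAB.volt_apply x _ hq, ← hvx, ← hvy]
            exact congrFun hgf (.inl q)
          · rw [← hAB.curr_apply y _ hq, ← hAB.curr_apply x _ hq, ← hix, ← hiy]
            exact congrFun hgf (.inr q)
      subst hxy
      exact eq_of_volt_curr (hvy.trans hvx.symm) (hiy.trans hix.symm)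
  · change Module.finrank ℝ p.device.direction = _
    have hr : LinearMap.range (Branch.equations (VSrc := VSrc) (ISrc := ISrc) p.values) = ⊤ := by
      refine LinearMap.range_eq_top.2 fun s => ?_
      obtain ⟨x, hx⟩ := hsurj (Sum.elim s 0)
      refine ⟨Sum.elim (fun b => A.mulVec x (.inl b)) (fun b => B.mulVec x (.inl b)), ?_⟩
      funext b
      have := congrFun hx (.inl b)
      rw [networkMatrix_mulVec_inl] at this
      exact this
    have h := LinearMap.finrank_range_add_finrank_ker
      (Branch.equations (VSrc := VSrc) (ISrc := ISrc) p.values)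
    rw [hr, finrank_top, Module.finrank_fintype_fun_eq_card, Module.finrank_fintype_fun_eq_card,
      Fintype.card_sum] at h
    rw [Parameters.direction_device]
    omega

-- Inverting the matrix expresses `x` through the sources and the port inputs; `W` reads off the
-- complementary port variables. The columns of `H` at ports give the hybrid matrix, those at device
-- branches, applied to the sources, the constant term.
open Classical in
theorem IsTreeParametrization.exists_isHybridForm (hAB : IsTreeParametrization G t A B)
    (hdet : (networkMatrix p.values A B).det ≠ 0) :
    ∃ H s, IsHybridForm (p.multiport G).behaviour {q | Sum.inr q ∈ t} H s := by
  have hdet' := hdet.isUnit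
  let W : Matrix P (Branch CCVS VCCS CCCS VCVS Res VSrc ISrc ⊕ P) ℝ :=
    Matrix.of fun q => if .inr q ∈ t then B (.inr q) else A (.inr q)
  let H := W * (networkMatrix p.values A B)⁻¹
  have hW : ∀ x q, W.mulVec x q = if .inr q ∈ t then B.mulVec x (.inr q)
      else A.mulVec x (.inr q) := by
    intro x q
    simp only [W, Matrix.mulVec, Matrix.of_apply]
    split_ifs <;> rfl
  have hH : ∀ (s : Branch CCVS VCCS CCCS VCVS Res VSrc ISrc → ℝ) (y : P → ℝ),
      H.mulVec (Sum.elim s y) = (H.submatrix id .inr).mulVec y + (H.submatrix id .inl).mulVec s := by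
    intro s y
    funext q
    simp [Matrix.mulVec, dotProduct, Fintype.sum_sum_type, add_comm]
  refine ⟨H.submatrix id .inr, (H.submatrix id .inl).mulVec p.sources, fun f => ?_⟩
  rw [← hH]
  have hf : f ∈ (p.multiport G).behaviour ↔
      ∃ g ∈ (p.multiport G).solutions, restrictP g = f := Iff.rfl
  have hsol := fun g => hAB.mem_solutions_iff (M := p.multiport G) (f := g) rfl
    (fun f => p.mem_device_iff)
  rw [hf]
  constructor
  · rintro ⟨g, hg, rfl⟩
    obtain ⟨x, hv, hi, hx⟩ := (hsol g).1 hg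
    have hx' : (networkMatrix p.values A B).mulVec x = Sum.elim p.sources (fun q =>
        if q ∈ {q | Sum.inr q ∈ t} then volt (restrictP g) q else curr (restrictP g) q) := by
      funext e
      rcases e with b | q
      · exact hx b
      · rw [networkMatrix_mulVec_inr, Sum.elim_inr]
        split_ifs with hq
        · exact (hAB.volt_apply x _ hq).symm.trans (congrFun hv (.inr q)).symm
        · exact (hAB.curr_apply x _ hq).symm.trans (congrFun hi (.inr q)).symm
    rw [← hx', Matrix.mulVec_mulVec, Matrix.mul_assoc, Matrix.nonsing_inv_mul _ hdet',
      Matrix.mul_one]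
    funext q
    rw [hW, ← hv, ← hi]
    rfl
  · intro h
    let y := Sum.elim p.sources (fun q =>
        if q ∈ {q | Sum.inr q ∈ t} then volt f q else curr f q)
    let x := (networkMatrix p.values A B)⁻¹.mulVec y
    have hx : (networkMatrix p.values A B).mulVec x = y := by
      rw [Matrix.mulVec_mulVec, Matrix.mul_nonsing_inv _ hdet', Matrix.one_mulVec]
    rw [← Matrix.mulVec_mulVec] at h
    refine ⟨Sum.elim (A.mulVec x) (B.mulVec x), (hsol _).2 ⟨x, rfl, rfl, fun b => ?_⟩, ?_⟩
    · rw [hx]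
      rfl
    have hq1 : ∀ q, x (.inr q) = if Sum.inr q ∈ t then volt f q else curr f q := by
      intro q
      rw [← networkMatrix_mulVec_inr p.values A B x, hx]
      rfl
    have hq2 : ∀ q, (if Sum.inr q ∈ t then curr f q else volt f q) =
        if .inr q ∈ t then B.mulVec x (.inr q) else A.mulVec x (.inr q) := by
      intro q
      rw [← hW]
      exact congrFun h q
    refine eq_of_volt_curr (funext fun q => ?_) (funext fun q => ?_)
    · change A.mulVec x (.inr q) = volt f q
      have h1 := hq1 q
      have h2 := hq2 q
      by_cases hq : .inr q ∈ t
      · rw [if_pos hq] at h1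
        rw [hAB.volt_apply x _ hq, h1]
      · rw [if_neg hq, if_neg hq] at h2
        exact h2.symm
    · change B.mulVec x (.inr q) = curr f q
      have h1 := hq1 q
      have h2 := hq2 q
      by_cases hq : .inr q ∈ t
      · rw [if_pos hq, if_pos hq] at h2
        exact h2.symm
      · rw [if_neg hq] at h1
        rw [hAB.curr_apply x _ hq, h1]

/-! ### Necessary conditions from rigidity. -/

theorem exists_solution_of_isRigid (h : (p.multiport G).IsRigid)
    (a : Branch CCVS VCCS CCCS VCVS Res VSrc ISrc ⊕ Branch CCVS VCCS CCCS VCVS Res VSrc ISrc → ℝ) :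
    ∃ f, volt f ∈ G.kvl ∧ curr f ∈ G.kcl ∧
      Branch.equations p.values (restrictS f) = Branch.equations p.values a := by
  -- Rigidity is applied to the translate of the device characteristic through `a`.
  obtain ⟨⟨f, ⟨hv, hi⟩, hf⟩, -⟩ := h
    ⟨G, AffineSubspace.mk' a p.device.direction, ⟨a, AffineSubspace.self_mem_mk' _ _⟩⟩ rfl
    (AffineSubspace.direction_mk' _ _)
  refine ⟨f, hv, hi, ?_⟩
  have hf' : restrictS f ∈ AffineSubspace.mk' a p.device.direction := hf
  rw [AffineSubspace.mem_mk', Parameters.direction_device, LinearMap.mem_ker, vsub_eq_sub, map_sub,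
    sub_eq_zero] at hf'
  exact hf'

-- On `Y₁ ∪ E` the device equations read off voltages, so some solution has voltage `1` on one edge
-- of the loop and `0` on its other edges, violating KVL.
open Classical in
theorem not_containsLoop_of_isRigid (h : (p.multiport G).IsRigid) :
    ¬ G.ContainsLoop (Y₁ P ∪ E P) := by
  rintro ⟨C, hC, l, hl, rfl⟩
  obtain ⟨a, ha⟩ := List.exists_mem_of_ne_nil _ hl.ne_nil
  have ha' : a.1 ∈ l.map Prod.fst := List.mem_map_of_mem ha
  obtain ⟨f, hv, -, hf⟩ := exists_solution_of_isRigid h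
    (Sum.elim (fun b => if .inl b = a.1 then 1 else 0) 0)
  have key : ∀ e ∈ Y₁ P ∪ E P, volt f e = if e = a.1 then 1 else 0 := by
    rintro _ ((⟨d, rfl⟩ | ⟨d, rfl⟩) | ⟨d, rfl⟩)
    · exact congrFun hf (.ccvsCtrl d)
    · exact congrFun hf (.cccsCtrl d)
    · exact congrFun hf (.vsource d)
  refine DiGraph.sum_signed_ne_zero hl.edges_nodup ha' (v := volt f) ?_ ?_ (hv l hl)
  · rw [key _ (hC ha')]
    simp
  · intro e he hea
    rw [key _ (hC he), if_neg hea]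

-- Dually, some solution has current `1` on `e` and `0` on the rest of the cutset; it is not
-- orthogonal to a potential difference supported on the cutset and nonzero at `e`.
open Classical in
theorem not_containsCutset_of_isRigid [Finite N] (h : (p.multiport G).IsRigid) :
    ¬ G.ContainsCutset (Y₂ P ∪ J P) := by
  rintro ⟨C, hC, hcut⟩
  obtain ⟨φ, e, he, hφe, hφ⟩ := hcut.exists_coboundary
  obtain ⟨f, -, hi, hf⟩ := exists_solution_of_isRigid h
    (Sum.elim 0 (fun b => if .inl b = e then 1 else 0))
  have key : ∀ e' ∈ Y₂ P ∪ J P, curr f e' = if e' = e then 1 else 0 := by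
    rintro _ ((⟨d, rfl⟩ | ⟨d, rfl⟩) | ⟨d, rfl⟩)
    · exact congrFun hf (.vccsCtrl d)
    · exact congrFun hf (.vcvsCtrl d)
    · exact congrFun hf (.isource d)
  have h0 := DiGraph.mem_kcl_iff.1 hi φ
  rw [Finset.sum_eq_single e] at h0
  · rw [key e (hC he), if_pos rfl, one_mul] at h0
    exact hφe h0
  · intro e' _ hne
    by_cases he' : e' ∈ C
    · rw [key e' (hC he'), if_neg hne, zero_mul]
    · rw [hφ e' he', mul_zero]
  · simp

end Network

theorem disjoint_sources {CCVS VCCS CCCS VCVS Res VSrc ISrc P : Type*} :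
    Disjoint (α := Set (Branch CCVS VCCS CCCS VCVS Res VSrc ISrc ⊕ P))
      (Z₁ P ∪ Y₁ P ∪ E P) (Z₂ P ∪ Y₂ P ∪ J P) := by
  rw [Set.disjoint_left]
  rintro _ (((⟨d, rfl⟩ | ⟨d, rfl⟩) | (⟨d, rfl⟩ | ⟨d, rfl⟩)) | ⟨d, rfl⟩) <;>
    simp [Z₂, Y₂, J]

end Multiport

/-! ### The main theorem. -/

open Multiport in
theorem mainTheorem4
    {N P CCVS VCCS CCCS VCVS Res VSrc ISrc : Type*} [Finite N] [Fintype P]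
    [Fintype CCVS] [Fintype VCCS] [Fintype CCCS] [Fintype VCVS]
    [Fintype Res] [Fintype VSrc] [Fintype ISrc]
    (G : Multiport.DiGraph N (Branch CCVS VCCS CCCS VCVS Res VSrc ISrc ⊕ P))
    (p : Parameters CCVS VCCS CCCS VCVS Res VSrc ISrc)
    (hp : AlgebraicIndependent ℚ p.values) :
    ((p.multiport G).IsProper →
      ¬ G.ContainsLoop (Y₁ P ∪ E P) ∧ ¬ G.ContainsCutset (Y₂ P ∪ J P)) ∧
    (¬ G.ContainsLoop (Z₁ P ∪ Y₁ P ∪ E P) → ¬ G.ContainsCutset (Z₂ P ∪ Y₂ P ∪ J P) →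
      (p.multiport G).IsProper ∧
      (∃ t, G.IsTree t ∧ Z₁ P ∪ Y₁ P ∪ E P ⊆ t ∧ Disjoint t (Z₂ P ∪ Y₂ P ∪ J P)) ∧
      ∀ t, G.IsTree t → Z₁ P ∪ Y₁ P ∪ E P ⊆ t → Disjoint t (Z₂ P ∪ Y₂ P ∪ J P) →
        HasHybridRepresentation (p.multiport G).behaviour {q | Sum.inr q ∈ t} ∧
        IsColumnBase (p.multiport G).behaviour.direction
          (Sum.inl '' {q | Sum.inr q ∈ t} ∪ Sum.inr '' {q | Sum.inr q ∉ t})) := by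
  classical
  -- The matrix and the special point `c₀` depend on the tree; genericity gives nonsingularity for
  -- each admissible tree separately.
  have key : ∀ t, G.IsTree t → Z₁ P ∪ Y₁ P ∪ E P ⊆ t → Disjoint t (Z₂ P ∪ Y₂ P ∪ J P) →
      ∃ A B, IsTreeParametrization G t A B ∧ (networkMatrix p.values A B).det ≠ 0 := by
    intro t ht h₁ h₂
    obtain ⟨A, B, hAB⟩ := ht.exists_isTreeParametrization
    obtain ⟨c₀, hc₀⟩ := hAB.exists_det_ne_zero h₁ h₂
    exact ⟨_, _, hAB, by convert det_networkMatrix_ne_zero hp A B (by convert hc₀)⟩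
  refine ⟨fun h => ⟨not_containsLoop_of_isRigid h.1, not_containsCutset_of_isRigid h.1⟩,
    fun hl hc => ?_⟩
  obtain ⟨t, ht, h₁, h₂⟩ := DiGraph.exists_isTree hl hc disjoint_sources
  refine ⟨?_, ⟨t, ht, h₁, h₂⟩, fun t ht h₁ h₂ => ?_⟩
  · obtain ⟨A, B, hAB, hdet⟩ := key t ht h₁ h₂
    exact hAB.isProper (by convert hdet)
  · obtain ⟨A, B, hAB, hdet⟩ := key t ht h₁ h₂
    obtain ⟨H, s, hH⟩ := hAB.exists_isHybridForm (by convert hdet)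
    exact ⟨hH.hasHybridRepresentation, hH.isColumnBase⟩
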